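/- **Setting.** All manifolds, maps, metrics and tensor fields are $C^\infty$, and manifolds are finite-dimensional, Hausdorff and without boundary. Let $(M,I,J,K,g_M)$ be a hyperkähler manifold: $g_M$ is a Riemannian metric with Levi-Civita connection $\nabla$, and $(I,J,K)=(J_1,J_2,J_3)$ are global endomorphism fields of $TM$ with $J_\alpha^2=-\mathrm{id}$, $J_\alpha J_{\alpha+1}=-J_{\alpha+1}J_\alpha=J_{\alpha+2}$ (indices mod $3$), $g_M(J_\alpha X,J_\alpha Y)=g_M(X,Y)$ and $\nabla J_\alpha=0$. Let $(N,g_N)$ be a Riemannian manifold and let $F:M\to N$ be a Riemannian map, i.e. for each $p\in M$ the differential $(F_*)_p$ maps $(\ker (F_*)_p)^\perp$ linearly and isometrically onto its image. Suppose that $F$ is almost h-semi-slant with almost h-semi-slant basis $(I,J,K)$: each point of $M$ has an open neighbourhood $U$ such that for each $R\in\{I,J,K\}$ there is a distribution $\mathcal D_1^R\subset\ker F_*$ on $U$ with $R(\mathcal D_1^R)=\mathcal D_1^R$ such that, with $\mathcal D_2^R$ the orthogonal complement of $\mathcal D_1^R$ in $\ker F_*$, the angle between $RX$ and $(\mathcal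 D_2^R)_q$ is the same for all $q\in U$ and all nonzero $X\in(\mathcal D_2^R)_q$. **Notation.** $\mathcal V$ and $\mathcal H$ are the orthogonal projections of $TM$ onto $\ker F_*$ and $(\ker F_*)^\perp$. For $R\in\{I,J,K\}$ put $\phi_RX=\mathcal V RX$, $\omega_RX=\mathcal H RX$ for $X\in\Gamma(\ker F_*)$, and $B_RZ=\mathcal V RZ$, $C_RZ=\mathcal H RZ$ for $Z\in\Gamma((\ker F_*)^\perp)$. For vector fields $X,Y$ put $$\mathcal A_XY=\mathcal H\nabla_{\mathcal HX}\mathcal VY+\mathcal V\nabla_{\mathcal HX}\mathcal HY,\qquad \mathcal T_XY=\mathcal H\nabla_{\mathcal VX}\mathcal VY+\mathcal V\nabla_{\mathcal VX}\mathcal HY,$$ and $\widehat\nabla_XY=\mathcal V\nabla_XY$ for $X,Y\in\Gamma(\ker F_*)$. **Theorem 4.1.** The following four conditions are equivalent. (a) $(M,g_M)$ is locally a Riemannian product manifold of the leaves of $\ker F_*$ and $(\ker F_*)^\perp$: each point of $M$ has an open neighbourhood that is isometric to a product $(V_1,h_1)\times(V_2,h_2)$ of connected Riemannian manifolds in such a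 way that the slices $V_1\times\{y_2\}$ are integral manifolds of $\ker F_*$ and the slices $\{y_1\}\times V_2$ are integral manifolds of $(\ker F_*)^\perp$. (b), (c), (d) For $R=I$ in (b), $R=J$ in (c), $R=K$ in (d): $$\omega_R(\widehat\nabla_X\phi_RY+\mathcal T_X\omega_RY)+C_R(\mathcal T_X\phi_RY+\mathcal H\nabla_X\omega_RY)=0\quad\text{for all }X,Y\in\Gamma(\ker F_*),$$ $$\phi_R(\mathcal V\nabla_ZB_RW+\mathcal A_ZC_RW)+B_R(\mathcal A_ZB_RW+\mathcal H\nabla_ZC_RW)=0\quad\text{for all }Z,W\in\Gamma((\ker F_*)^\perp).$$ -/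

import Mathlib

open Bundle
open scoped Manifold ContDiff

noncomputable section

namespace HSemiSlant

section OneManifold

variable {E : Type*} [NormedAddCommGroup E] [NormedSpace ℝ E] [FiniteDimensional ℝ E]
  {M : Type*} [TopologicalSpace M] [ChartedSpace E M] [IsManifold 𝓘(ℝ, E) ∞ M]

/-- Tangent spaces of a finite-dimensional manifold are finite-dimensional. -/
instance instFiniteDimensionalTangentSpace (x : M) :
    FiniteDimensional ℝ (TangentSpace 𝓘(ℝ, E) x) :=
  inferInstanceAs (FiniteDimensional ℝ E)

/-- A (not necessarily smooth) vector field on `M`. -/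
abbrev VField (E : Type*) [NormedAddCommGroup E] [NormedSpace ℝ E]
    (M : Type*) [TopologicalSpace M] [ChartedSpace E M] : Type _ :=
  ∀ x : M, TangentSpace 𝓘(ℝ, E) x

/-- A (not necessarily smooth) field of endomorphisms of the tangent spaces of `M`. -/
abbrev EndField (E : Type*) [NormedAddCommGroup E] [NormedSpace ℝ E]
    (M : Type*) [TopologicalSpace M] [ChartedSpace E M] : Type _ :=
  ∀ x : M, TangentSpace 𝓘(ℝ, E) x →L[ℝ] TangentSpace 𝓘(ℝ, E) x

/-- A (not necessarily smooth) family of linear subspaces of the tangent spaces of `M`. -/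
abbrev SubspaceField (E : Type*) [NormedAddCommGroup E] [NormedSpace ℝ E]
    (M : Type*) [TopologicalSpace M] [ChartedSpace E M] : Type _ :=
  ∀ x : M, Submodule ℝ (TangentSpace 𝓘(ℝ, E) x)

/-- The vector field `X` is of class `C^∞` on the set `U`. -/
def SmoothFieldOn (X : VField E M) (U : Set M) : Prop :=
  ContMDiffOn 𝓘(ℝ, E) (𝓘(ℝ, E).prod 𝓘(ℝ, E)) ∞
    (fun x ↦ (⟨x, X x⟩ : TangentBundle 𝓘(ℝ, E) M)) U

/-- The endomorphism field `J` is of class `C^∞`, as a section of the bundle `End (TM)`. -/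
def SmoothEndField (J : EndField E M) : Prop :=
  ContMDiff 𝓘(ℝ, E) (𝓘(ℝ, E).prod 𝓘(ℝ, E →L[ℝ] E)) ∞
    (fun x ↦ Bundle.TotalSpace.mk' (E →L[ℝ] E)
      (E := fun x : M ↦ TangentSpace 𝓘(ℝ, E) x →L[ℝ] TangentSpace 𝓘(ℝ, E) x) x (J x))

/-- `X ∈ Γ(D)`: a global `C^∞` vector field with values in the distribution `D`. -/
def IsSection (D : SubspaceField E M) (X : VField E M) : Prop :=
  SmoothFieldOn X Set.univ ∧ ∀ x, X x ∈ D x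

/-- `D` is a `C^∞` distribution on the open set `U`: a smooth subbundle of `TM` over `U`, that is,
near each point of `U` it has a frame consisting of `C^∞` vector fields. -/
def IsSmoothDistributionOn (D : SubspaceField E M) (U : Set M) : Prop :=
  ∀ p ∈ U, ∃ V : Set M, IsOpen V ∧ p ∈ V ∧ V ⊆ U ∧ ∃ (k : ℕ) (X : Fin k → VField E M),
    (∀ i, SmoothFieldOn (X i) V) ∧
    ∀ x ∈ V, LinearIndependent ℝ (fun i ↦ X i x) ∧
      Submodule.span ℝ (Set.range fun i ↦ X i x) = D x

/-! From here on `M` carries a Riemannian metric, written `inner ℝ` on each tangent space. -/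

variable [RiemannianBundle (fun x : M ↦ TangentSpace 𝓘(ℝ, E) x)]

/-- The right-hand side of Koszul's formula,
`X g(Y,Z) + Y g(X,Z) - Z g(X,Y) + g([X,Y],Z) - g([X,Z],Y) - g([Y,Z],X)`, at the point `x`. -/
def koszul (X Y Z : VField E M) (x : M) : ℝ :=
  mvfderiv 𝓘(ℝ, E) (fun y ↦ (inner ℝ (Y y) (Z y) : ℝ)) x (X x)
    + mvfderiv 𝓘(ℝ, E) (fun y ↦ (inner ℝ (X y) (Z y) : ℝ)) x (Y x)
    - mvfderiv 𝓘(ℝ, E) (fun y ↦ (inner ℝ (X y) (Y y) : ℝ)) x (Z x)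
    + inner ℝ (VectorField.mlieBracket 𝓘(ℝ, E) X Y x) (Z x)
    - inner ℝ (VectorField.mlieBracket 𝓘(ℝ, E) X Z x) (Y x)
    - inner ℝ (VectorField.mlieBracket 𝓘(ℝ, E) Y Z x) (X x)

/-- The covariant derivative `∇_X Y` for the Levi-Civita connection of the metric. At `x` it is the
vector `v` with `2 g(v, Z x) = koszul X Y Z x` for all `Z`, written out in an orthonormal basis of
the tangent space; the right-hand side depends on `Z` only through `Z x`, so the basis vectors may
be extended to vector fields in any way that is differentiable at `x`. -/
def nabla (X Y : VField E M) : VField E M := fun x ↦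
  ∑ i, ((1 / 2 : ℝ) * koszul X Y
      (FiberBundle.extend E (stdOrthonormalBasis ℝ (TangentSpace 𝓘(ℝ, E) x) i)) x) •
    (stdOrthonormalBasis ℝ (TangentSpace 𝓘(ℝ, E) x) i)

/-- `(J 0, J 1, J 2) = (I, J, K)` is a hyperkähler structure on `M` together with the given metric:
a global `C^∞` quaternionic Hermitian basis which is parallel for the Levi-Civita connection.
Indices are taken modulo `3`. -/
structure IsHyperkahler (J : Fin 3 → EndField E M) : Prop where
  smooth : ∀ a, SmoothEndField (J a)
  sq : ∀ a x v, J a x (J a x v) = -v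
  mul : ∀ a x v, J a x (J (a + 1) x v) = J (a + 2) x v
  mul_rev : ∀ a x v, J (a + 1) x (J a x v) = -J (a + 2) x v
  hermitian : ∀ a x v w, (inner ℝ (J a x v) (J a x w) : ℝ) = inner ℝ v w
  parallel : ∀ a (X Y : VField E M), SmoothFieldOn X Set.univ → SmoothFieldOn Y Set.univ →
    ∀ x, nabla X (fun y ↦ J a y (Y y)) x = J a x (nabla X Y x)

/-- The angle between a vector `v` and a subspace `W` of a tangent space: the least angle between
`v` and a nonzero vector of `W`. -/
def angleToSubspace {x : M} (v : TangentSpace 𝓘(ℝ, E) x)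
    (W : Submodule ℝ (TangentSpace 𝓘(ℝ, E) x)) : ℝ :=
  ⨅ w : {w : TangentSpace 𝓘(ℝ, E) x // w ∈ W ∧ w ≠ 0}, InnerProductGeometry.angle v w.1

/-- A `C^∞` Riemannian metric on an open subset `V` of a Euclidean space. -/
structure IsMetricOn {n : ℕ} (V : Set (EuclideanSpace ℝ (Fin n)))
    (h : EuclideanSpace ℝ (Fin n) →
      EuclideanSpace ℝ (Fin n) →L[ℝ] EuclideanSpace ℝ (Fin n) →L[ℝ] ℝ) : Prop where
  smooth : ContDiffOn ℝ ∞ h V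
  symm : ∀ y ∈ V, ∀ u v, h y u v = h y v u
  pos : ∀ y ∈ V, ∀ u, u ≠ 0 → 0 < h y u u

/-- `M` is locally a Riemannian product manifold of the leaves of the distribution `D` and of its
orthogonal complement. Around each point there is a diffeomorphism `e = (e₁, e₂)` of an open set
onto a product `V₁ × V₂` of connected manifolds (without loss of generality open subsets of
Euclidean spaces) with Riemannian metrics `h₁`, `h₂`, such that `e` is an isometry for the product
metric `h₁ + h₂`, the slices `V₁ × {y₂}` are integral manifolds of `D`, and the slices
`{y₁} × V₂` are integral manifolds of `Dᗮ`. So the two factors are isometric to open pieces of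
leaves of `D` and of `Dᗮ`. -/
def IsLocalRiemannianProduct (D : SubspaceField E M) : Prop :=
  ∀ p : M, ∃ (a b : ℕ)
    (e : OpenPartialHomeomorph M (EuclideanSpace ℝ (Fin a) × EuclideanSpace ℝ (Fin b)))
    (V₁ : Set (EuclideanSpace ℝ (Fin a))) (V₂ : Set (EuclideanSpace ℝ (Fin b)))
    (h₁ : EuclideanSpace ℝ (Fin a) →
      EuclideanSpace ℝ (Fin a) →L[ℝ] EuclideanSpace ℝ (Fin a) →L[ℝ] ℝ)
    (h₂ : EuclideanSpace ℝ (Fin b) →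
      EuclideanSpace ℝ (Fin b) →L[ℝ] EuclideanSpace ℝ (Fin b) →L[ℝ] ℝ),
    p ∈ e.source ∧ e.target = V₁ ×ˢ V₂ ∧
    IsOpen V₁ ∧ IsConnected V₁ ∧ IsOpen V₂ ∧ IsConnected V₂ ∧
    IsMetricOn V₁ h₁ ∧ IsMetricOn V₂ h₂ ∧
    ContMDiffOn 𝓘(ℝ, E) 𝓘(ℝ, EuclideanSpace ℝ (Fin a) × EuclideanSpace ℝ (Fin b)) ∞ e e.source ∧
    ContMDiffOn 𝓘(ℝ, EuclideanSpace ℝ (Fin a) × EuclideanSpace ℝ (Fin b)) 𝓘(ℝ, E) ∞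
      e.symm e.target ∧
    ∀ x ∈ e.source,
      (∀ u v : TangentSpace 𝓘(ℝ, E) x, (inner ℝ u v : ℝ) =
        h₁ (e x).1 (mvfderiv 𝓘(ℝ, E) (fun z ↦ (e z).1) x u)
            (mvfderiv 𝓘(ℝ, E) (fun z ↦ (e z).1) x v)
          + h₂ (e x).2 (mvfderiv 𝓘(ℝ, E) (fun z ↦ (e z).2) x u)
            (mvfderiv 𝓘(ℝ, E) (fun z ↦ (e z).2) x v)) ∧
      (∀ u : TangentSpace 𝓘(ℝ, E) x,
        u ∈ D x ↔ mvfderiv 𝓘(ℝ, E) (fun z ↦ (e z).2) x u = 0) ∧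
      (∀ u : TangentSpace 𝓘(ℝ, E) x,
        u ∈ (D x)ᗮ ↔ mvfderiv 𝓘(ℝ, E) (fun z ↦ (e z).1) x u = 0)

/-! The splitting `TM = D ⊕ Dᗮ` and the operators attached to it. For `D = ker F_*`, sections of
`D` are the vertical fields and sections of `Dᗮ` the horizontal ones. -/

/-- The vertical part `𝒱X`, the orthogonal projection of `X` onto `D`. -/
def vert (D : SubspaceField E M) (X : VField E M) : VField E M :=
  fun x ↦ (D x).starProjection (X x)

/-- The horizontal part `ℋX`, the orthogonal projection of `X` onto `Dᗮ`. -/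
def hor (D : SubspaceField E M) (X : VField E M) : VField E M :=
  fun x ↦ (D x)ᗮ.starProjection (X x)

/-- `φ_R X = 𝒱(RX)` for vertical `X`. -/
def phi (D : SubspaceField E M) (R : EndField E M) (X : VField E M) : VField E M :=
  vert D fun x ↦ R x (X x)

/-- `ω_R X = ℋ(RX)` for vertical `X`. -/
def omega (D : SubspaceField E M) (R : EndField E M) (X : VField E M) : VField E M :=
  hor D fun x ↦ R x (X x)

/-- `B_R Z = 𝒱(RZ)` for horizontal `Z`. -/
def opB (D : SubspaceField E M) (R : EndField E M) (Z : VField E M) : VField E M :=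
  vert D fun x ↦ R x (Z x)

/-- `C_R Z = ℋ(RZ)` for horizontal `Z`. -/
def opC (D : SubspaceField E M) (R : EndField E M) (Z : VField E M) : VField E M :=
  hor D fun x ↦ R x (Z x)

/-- The tensor `𝒜_X Y = ℋ∇_{ℋX} 𝒱Y + 𝒱∇_{ℋX} ℋY`. -/
def tensorA (D : SubspaceField E M) (X Y : VField E M) : VField E M :=
  hor D (nabla (hor D X) (vert D Y)) + vert D (nabla (hor D X) (hor D Y))

/-- The tensor `𝒯_X Y = ℋ∇_{𝒱X} 𝒱Y + 𝒱∇_{𝒱X} ℋY`. -/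
def tensorT (D : SubspaceField E M) (X Y : VField E M) : VField E M :=
  hor D (nabla (vert D X) (vert D Y)) + vert D (nabla (vert D X) (hor D Y))

/-- `∇̂_X Y = 𝒱∇_X Y` for vertical `X`, `Y`. -/
def nablaHat (D : SubspaceField E M) (X Y : VField E M) : VField E M :=
  vert D (nabla X Y)

/-- `ω_R(∇̂_X φ_R Y + 𝒯_X ω_R Y) + C_R(𝒯_X φ_R Y + ℋ∇_X ω_R Y) = 0` for all `X, Y ∈ Γ(D)`. -/
def VerticalIdentity (D : SubspaceField E M) (R : EndField E M) : Prop :=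
  ∀ X Y : VField E M, IsSection D X → IsSection D Y →
    omega D R (nablaHat D X (phi D R Y) + tensorT D X (omega D R Y))
      + opC D R (tensorT D X (phi D R Y) + hor D (nabla X (omega D R Y))) = 0

/-- `φ_R(𝒱∇_Z B_R W + 𝒜_Z C_R W) + B_R(𝒜_Z B_R W + ℋ∇_Z C_R W) = 0` for all `Z, W ∈ Γ(Dᗮ)`. -/
def HorizontalIdentity (D : SubspaceField E M) (R : EndField E M) : Prop :=
  ∀ Z W : VField E M, IsSection (fun x ↦ (D x)ᗮ) Z → IsSection (fun x ↦ (D x)ᗮ) W →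
    phi D R (vert D (nabla Z (opB D R W)) + tensorA D Z (opC D R W))
      + opB D R (tensorA D Z (opB D R W) + hor D (nabla Z (opC D R W))) = 0

end OneManifold

section Maps

variable {E : Type*} [NormedAddCommGroup E] [NormedSpace ℝ E] [FiniteDimensional ℝ E]
  {M : Type*} [TopologicalSpace M] [ChartedSpace E M] [IsManifold 𝓘(ℝ, E) ∞ M]
  [RiemannianBundle (fun x : M ↦ TangentSpace 𝓘(ℝ, E) x)]
  {E' : Type*} [NormedAddCommGroup E'] [NormedSpace ℝ E'] [FiniteDimensional ℝ E']
  {N : Type*} [TopologicalSpace N] [ChartedSpace E' N] [IsManifold 𝓘(ℝ, E') ∞ N]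
  [RiemannianBundle (fun y : N ↦ TangentSpace 𝓘(ℝ, E') y)]

variable (E E') in
/-- The family of subspaces `ker F_*`. -/
def kerField (F : M → N) : SubspaceField E M :=
  fun x ↦ LinearMap.ker (mfderiv 𝓘(ℝ, E) 𝓘(ℝ, E') F x).toLinearMap

variable (E E') in
/-- `F` is a Riemannian map: it is of class `C^∞`, and at each point its differential is a linear
isometry from `(ker F_*)ᗮ` onto the range of `F_*`. -/
def IsRiemannianMap (F : M → N) : Prop :=
  ContMDiff 𝓘(ℝ, E) 𝓘(ℝ, E') ∞ F ∧
  ∀ x : M, ∀ u ∈ (kerField E E' F x)ᗮ, ∀ v ∈ (kerField E E' F x)ᗮ,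
    (inner ℝ (mfderiv 𝓘(ℝ, E) 𝓘(ℝ, E') F x u) (mfderiv 𝓘(ℝ, E) 𝓘(ℝ, E') F x v) : ℝ)
      = inner ℝ u v

variable (E') in
/-- `F` is an almost h-semi-slant Riemannian map and `(J 0, J 1, J 2)` is an almost h-semi-slant
basis: each point has an open neighbourhood `U` such that for each `R = J a` there is a `C^∞`
distribution `D₁ ⊆ ker F_*` on `U` with `R D₁ = D₁`, such that the angle between `R X` and `D₂` is
the same for all nonzero `X` in `D₂`, where `D₂` is the orthogonal complement of `D₁` in
`ker F_*`. -/
def IsAlmostHSemiSlant (F : M → N) (J : Fin 3 → EndField E M) : Prop :=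
  IsRiemannianMap E E' F ∧
  ∀ p : M, ∃ U : Set M, IsOpen U ∧ p ∈ U ∧ ∀ a : Fin 3,
    ∃ D₁ : SubspaceField E M, IsSmoothDistributionOn D₁ U ∧
      (∀ x ∈ U, D₁ x ≤ kerField E E' F x) ∧
      (∀ x ∈ U, (D₁ x).map (J a x).toLinearMap = D₁ x) ∧
      ∃ θ : ℝ, ∀ x ∈ U, ∀ X ∈ (D₁ x)ᗮ ⊓ kerField E E' F x, X ≠ 0 →
        angleToSubspace (J a x X) ((D₁ x)ᗮ ⊓ kerField E E' F x) = θ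

end Maps

end HSemiSlant

end

/-! Write `D` for `ker F_*`, and call `D` totally geodesic when `∇_X Y` lies in `D` for all sections
`X`, `Y` of `D`. The middle term of the equivalence is that `D` and `Dᗮ` are both totally geodesic,
a condition in which `R` does not appear.

The algebraic half rests on `R` being parallel. For vertical `X`, `Y` we have `RY = φ_R Y + ω_R Y`,
and the left side of the vertical identity regroups as `ℋ(R ∇_X(RY)) = ℋ(R² ∇_X Y) = -ℋ ∇_X Y`. So
that identity says exactly that `D` is totally geodesic (`verticalIdentity_iff_isTotallyGeodesic`),
and the horizontal identity is the same statement for `Dᗮ`. The projections must preserve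
smoothness; the isometry property of `F_*` on `Dᗮ` gives this (`IsRiemannianMap.isSmoothSplitting`),
with no constant-rank assumption.

The geometric half is a local de Rham splitting. In a Riemannian product, Koszul's formula gives
`g(∇_X Y, Z) = 0` for `X`, `Y` in one factor and `Z` in the other (`koszul_eq_zero_of_product`).
Conversely, total geodesy implies involutivity because the connection is torsion-free, so Frobenius'
theorem yields local submersions with kernels `D` and `Dᗮ`. Together they form a chart. For its
coordinate fields the brackets vanish, and Koszul's formula reduces to `Z g(X, Y) = 0` for `X`, `Y`
in one distribution and `Z` in the other. Each diagonal block of the metric therefore depends only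
on its own coordinates, and the mixed block is zero by orthogonality (`gram_eq_add_of_product`).

Frobenius' theorem is proved for a distribution that is the graph of `A : W₁ × W₂ → (W₂ →L[ℝ] W₁)`.
Solve `u' = A(u, t y) y` along each ray `t ↦ t y`. Smooth dependence on `y` and on the initial value
comes from the inverse function theorem in the Banach space `C(I, W₁)`. Integrability, with
uniqueness for linear ODEs, shows that the endpoints for a fixed initial value sweep out a leaf
(`exists_straightening`). -/

noncomputable section

namespace HSemiSlant

set_option linter.unusedSectionVars false

universe u

/-! ### Koszul's formula and the Levi-Civita connection -/

section Koszul

variable {E : Type*} [NormedAddCommGroup E] [NormedSpace ℝ E] [FiniteDimensional ℝ E]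
  {M : Type*} [TopologicalSpace M] [ChartedSpace E M] [IsManifold 𝓘(ℝ, E) ∞ M]
variable [RiemannianBundle (fun x : M ↦ TangentSpace 𝓘(ℝ, E) x)]
    [IsContMDiffRiemannianBundle 𝓘(ℝ, E) ∞ E (fun x : M ↦ TangentSpace 𝓘(ℝ, E) x)]

theorem contMDiffAt_inner {X Y : VField E M} {x : M} (hX : CMDiffAt ∞ (T% X) x)
    (hY : CMDiffAt ∞ (T% Y) x) :
    ContMDiffAt 𝓘(ℝ, E) 𝓘(ℝ) ∞ (fun y ↦ (inner ℝ (X y) (Y y) : ℝ)) x :=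
  ContMDiffAt.inner_bundle (E := fun x : M ↦ TangentSpace 𝓘(ℝ, E) x) (b := id) hX hY

theorem mdifferentiableAt_inner {X Y : VField E M} {x : M} (hX : MDiffAt (T% X) x)
    (hY : MDiffAt (T% Y) x) :
    MDifferentiableAt 𝓘(ℝ, E) 𝓘(ℝ) (fun y ↦ (inner ℝ (X y) (Y y) : ℝ)) x :=
  have : IsContMDiffRiemannianBundle 𝓘(ℝ, E) 1 E (fun x : M ↦ TangentSpace 𝓘(ℝ, E) x) :=
    inferInstance
  MDifferentiableAt.inner_bundle (E := fun x : M ↦ TangentSpace 𝓘(ℝ, E) x) (b := id) hX hY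

/-- Replacing `Z` by `f Z`, the derivatives of `f` along `X` and `Y` from the first two terms cancel
those from the brackets `[X, f Z]` and `[Y, f Z]`. -/
theorem koszul_tensorial {X Y : VField E M} {x : M} (hX : MDiffAt (T% X) x)
    (hY : MDiffAt (T% Y) x) :
    TensorialAt 𝓘(ℝ, E) E (fun Z : VField E M ↦ koszul X Y Z x) x where
  smul {f Z} hf hZ := by
    have h1 := mdifferentiableAt_inner hX hZ
    have h2 := mdifferentiableAt_inner hY hZ
    simp only [koszul, Pi.smul_apply', real_inner_smul_right, map_smul,
      VectorField.mlieBracket_smul_right hf hZ]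
    rw [mvfderiv_fun_mul hf h1, mvfderiv_fun_mul hf h2]
    simp [inner_add_left, real_inner_smul_left, inner_add_left]
    rw [real_inner_comm (Z x), real_inner_comm (Z x), real_inner_comm (X x)]
    ring
  add {Z Z'} hZ hZ' := by
    have h1 := mdifferentiableAt_inner hX hZ
    have h2 := mdifferentiableAt_inner hY hZ
    have h1' := mdifferentiableAt_inner hX hZ'
    have h2' := mdifferentiableAt_inner hY hZ'
    simp only [koszul, Pi.add_apply, inner_add_right, map_add,
      VectorField.mlieBracket_add_right hZ hZ']
    rw [mvfderiv_fun_add h1 h1', mvfderiv_fun_add h2 h2']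
    simp [inner_add_left]
    ring

/-- By tensoriality in `Z`, the extensions of basis vectors used to define `nabla` do not matter,
and expanding `Z x` in the orthonormal basis recovers the whole functional. -/
theorem inner_nabla_eq_koszul {X Y Z : VField E M} {x : M} (hX : MDiffAt (T% X) x)
    (hY : MDiffAt (T% Y) x) (hZ : MDiffAt (T% Z) x) :
    (inner ℝ (nabla X Y x) (Z x) : ℝ) = (1 / 2 : ℝ) * koszul X Y Z x := by
  have hT := koszul_tensorial hX hY
  have key : ∀ v, koszul X Y (FiberBundle.extend E v) x = TensorialAt.mkHom _ x hT v :=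
    fun v ↦ (hT.mkHom_apply_eq_extend v).symm
  simp only [nabla, key, sum_inner, real_inner_smul_left]
  rw [← hT.mkHom_apply hZ]
  conv_rhs => rw [← (stdOrthonormalBasis ℝ (TangentSpace 𝓘(ℝ, E) x)).sum_repr' (Z x), map_sum,
    Finset.mul_sum]
  refine Finset.sum_congr rfl fun i _ ↦ ?_
  rw [map_smul, smul_eq_mul]
  ring

theorem koszul_add_middle {X Y Y' Z : VField E M} {x : M} (hX : MDiffAt (T% X) x)
    (hY : MDiffAt (T% Y) x) (hY' : MDiffAt (T% Y') x) (hZ : MDiffAt (T% Z) x) :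
    koszul X (Y + Y') Z x = koszul X Y Z x + koszul X Y' Z x := by
  have h1 := mdifferentiableAt_inner hX hY
  have h2 := mdifferentiableAt_inner hY hZ
  have h1' := mdifferentiableAt_inner hX hY'
  have h2' := mdifferentiableAt_inner hY' hZ
  simp only [koszul, Pi.add_apply, inner_add_right, map_add, inner_add_left,
      VectorField.mlieBracket_add_right hY hY', VectorField.mlieBracket_add_left hY hY']
  rw [mvfderiv_fun_add h1 h1', mvfderiv_fun_add h2 h2']
  simp
  ring

theorem nabla_add {X Y Y' : VField E M} {x : M} (hX : MDiffAt (T% X) x)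
    (hY : MDiffAt (T% Y) x) (hY' : MDiffAt (T% Y') x) :
    nabla X (Y + Y') x = nabla X Y x + nabla X Y' x := by
  simp only [nabla, ← Finset.sum_add_distrib, ← add_smul, ← mul_add]
  refine Finset.sum_congr rfl fun i _ ↦ ?_
  rw [koszul_add_middle hX hY hY' (FiberBundle.mdifferentiableAt_extend ..)]

theorem nabla_zero (X : VField E M) : nabla X 0 = 0 := by
  ext x
  simp [nabla, koszul, mvfderiv_const]

/-- This is torsion-freeness of the connection, tested against `Z`. -/
theorem koszul_sub_koszul_swap (X Y Z : VField E M) (x : M) :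
    koszul X Y Z x - koszul Y X Z x =
      2 * inner ℝ (VectorField.mlieBracket 𝓘(ℝ, E) X Y x) (Z x) := by
  have h : (fun y ↦ (inner ℝ (X y) (Y y) : ℝ)) = fun y ↦ (inner ℝ (Y y) (X y) : ℝ) :=
    funext fun y ↦ real_inner_comm _ _
  simp only [koszul, h]
  rw [VectorField.mlieBracket_swap_apply (V := Y) (W := X), inner_neg_left]
  ring

theorem koszul_congr {X X' Y Y' Z Z' : VField E M} {x : M} (hX : X =ᶠ[nhds x] X')
    (hY : Y =ᶠ[nhds x] Y') (hZ : Z =ᶠ[nhds x] Z') : koszul X Y Z x = koszul X' Y' Z' x := by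
  have aux {A A' B B' : VField E M} (hA : A =ᶠ[nhds x] A') (hB : B =ᶠ[nhds x] B') :
      mvfderiv 𝓘(ℝ, E) (fun y ↦ (inner ℝ (A y) (B y) : ℝ)) x =
        mvfderiv 𝓘(ℝ, E) (fun y ↦ (inner ℝ (A' y) (B' y) : ℝ)) x := by
    have : (fun y ↦ (inner ℝ (A y) (B y) : ℝ)) =ᶠ[nhds x] fun y ↦ (inner ℝ (A' y) (B' y) : ℝ) := by
      filter_upwards [hA, hB] with y h h'
      rw [h, h']
    simp only [mvfderiv, this.mfderiv_eq]
    congr 2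
  simp only [koszul, aux hX hY, aux hX hZ, aux hY hZ, hX.mlieBracket_vectorField_eq hY,
    hX.mlieBracket_vectorField_eq hZ, hY.mlieBracket_vectorField_eq hZ, hX.self_of_nhds,
    hY.self_of_nhds, hZ.self_of_nhds]

end Koszul

/-! ### Vector fields as derivations -/

section Derivations

variable {E : Type*} [NormedAddCommGroup E] [NormedSpace ℝ E] [FiniteDimensional ℝ E]
  {M : Type*} [TopologicalSpace M] [ChartedSpace E M] [IsManifold 𝓘(ℝ, E) ∞ M]
  {E' : Type*} [NormedAddCommGroup E'] [NormedSpace ℝ E']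
  {N : Type*} [TopologicalSpace N] [ChartedSpace E' N] [IsManifold 𝓘(ℝ, E') ∞ N]
  {W : Type*} [NormedAddCommGroup W] [NormedSpace ℝ W]
  {W' : Type*} [NormedAddCommGroup W'] [NormedSpace ℝ W']

theorem contMDiffAt_mfderiv_apply {F : M → N} {X : VField E M} {x : M}
    (hF : ContMDiffAt 𝓘(ℝ, E) 𝓘(ℝ, E') ∞ F x) (hX : CMDiffAt ∞ (T% X) x) :
    ContMDiffAt 𝓘(ℝ, E) (𝓘(ℝ, E').prod 𝓘(ℝ, E')) ∞
      (fun y ↦ (⟨F y, mfderiv 𝓘(ℝ, E) 𝓘(ℝ, E') F y (X y)⟩ : TangentBundle 𝓘(ℝ, E') N)) x := by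
  have h1 := hF.mfderiv_const (m := ∞) (by simp)
  exact ContMDiffAt.clm_apply_of_inCoordinates (b₁ := id) (b₂ := F)
    (E₁ := fun y : M ↦ TangentSpace 𝓘(ℝ, E) y) (E₂ := fun y : N ↦ TangentSpace 𝓘(ℝ, E') y)
    (ϕ := fun y ↦ mfderiv 𝓘(ℝ, E) 𝓘(ℝ, E') F y) h1 hX hF

theorem contMDiffAt_mvfderiv_apply {f : M → W} {X : VField E M} {x : M}
    (hf : ContMDiffAt 𝓘(ℝ, E) 𝓘(ℝ, W) ∞ f x) (hX : CMDiffAt ∞ (T% X) x) :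
    ContMDiffAt 𝓘(ℝ, E) 𝓘(ℝ, W) ∞ (fun y ↦ mvfderiv 𝓘(ℝ, E) f y (X y)) x := by
  have h := contMDiffAt_mfderiv_apply hf hX
  exact (contMDiff_snd_tangentBundle_modelSpace W 𝓘(ℝ, W)).contMDiffAt.comp x h

theorem mvfderiv_congr {f g : M → W} {x : M} (h : f =ᶠ[nhds x] g) (u : TangentSpace 𝓘(ℝ, E) x) :
    mvfderiv 𝓘(ℝ, E) f x u = mvfderiv 𝓘(ℝ, E) g x u := by
  have := h.mfderiv_eq (I := 𝓘(ℝ, E)) (I' := 𝓘(ℝ, W))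
  exact congrArg (fun L : E →L[ℝ] W ↦ L u) this

theorem mvfderiv_comp_fderiv {f : M → W} {g : W → W'} {x : M} (hg : DifferentiableAt ℝ g (f x))
    (hf : MDiffAt f x) (u : TangentSpace 𝓘(ℝ, E) x) :
    mvfderiv 𝓘(ℝ, E) (fun y ↦ g (f y)) x u = fderiv ℝ g (f x) (mvfderiv 𝓘(ℝ, E) f x u) := by
  have h := mfderiv_comp_apply (I := 𝓘(ℝ, E)) (I' := 𝓘(ℝ, W)) (I'' := 𝓘(ℝ, W')) (g := g) x
    hg.mdifferentiableAt hf u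
  rw [mfderiv_eq_fderiv] at h
  exact h

theorem mvfderiv_eq_fderiv_writtenInChart {f : M → W} {x y : M} (hf : MDiffAt f y)
    (hy : y ∈ (extChartAt 𝓘(ℝ, E) x).source) (u : TangentSpace 𝓘(ℝ, E) y) :
    mvfderiv 𝓘(ℝ, E) f y u = fderiv ℝ (fun z ↦ f ((extChartAt 𝓘(ℝ, E) x).symm z))
      (extChartAt 𝓘(ℝ, E) x y) (mvfderiv 𝓘(ℝ, E) (extChartAt 𝓘(ℝ, E) x) y u) := by
  have hφ : MDiffAt (extChartAt 𝓘(ℝ, E) x) y :=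
    (contMDiffAt_extChartAt' (n := 1) (by simpa using hy)).mdifferentiableAt one_ne_zero
  rw [← mvfderiv_comp_fderiv _ hφ]
  · refine mvfderiv_congr ?_ u
    filter_upwards [(isOpen_extChartAt_source x).mem_nhds hy] with z hz
    rw [(extChartAt 𝓘(ℝ, E) x).left_inv hz]
  · refine MDifferentiableAt.differentiableAt ?_
    have h2 := mdifferentiableWithinAt_extChartAt_symm ((extChartAt 𝓘(ℝ, E) x).map_source hy)
    simp only [modelWithCornersSelf_coe, Set.range_id, mdifferentiableWithinAt_univ] at h2
    refine MDifferentiableAt.comp (I' := 𝓘(ℝ, E)) _ ?_ h2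
    rwa [(extChartAt 𝓘(ℝ, E) x).left_inv hy]

theorem mpullbackWithin_extChartAt_symm_apply (X : VField E M) {x y : M}
    (hy : y ∈ (extChartAt 𝓘(ℝ, E) x).source) :
    VectorField.mpullbackWithin 𝓘(ℝ, E) 𝓘(ℝ, E) (extChartAt 𝓘(ℝ, E) x).symm X
      (Set.range 𝓘(ℝ, E)) (extChartAt 𝓘(ℝ, E) x y)
      = mvfderiv 𝓘(ℝ, E) (extChartAt 𝓘(ℝ, E) x) y (X y) := by
  have hinv := isInvertible_mfderivWithin_extChartAt_symm (I := 𝓘(ℝ, E))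
    ((extChartAt 𝓘(ℝ, E) x).map_source hy)
  have h0 : ∀ y', y' = y → (X y' : E) = X y := by rintro _ rfl; rfl
  have h1 := congrArg (fun L : E →L[ℝ] E ↦ L (X y))
    (mfderivWithin_extChartAt_symm_comp_mfderiv_extChartAt' (I := 𝓘(ℝ, E)) hy)
  refine (hinv.inverse_apply_eq).2 ?_
  exact (h0 _ ((extChartAt 𝓘(ℝ, E) x).left_inv hy)).trans h1.symm

/-- In a chart this is the symmetry of the second derivative of `f`. Later bracket computations go
through this commutator formula instead of returning to charts. -/
theorem mvfderiv_mlieBracket {f : M → W} {X Y : VField E M} {x : M}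
    (hf : ContMDiffAt 𝓘(ℝ, E) 𝓘(ℝ, W) ∞ f x) (hX : MDiffAt (T% X) x) (hY : MDiffAt (T% Y) x) :
    mvfderiv 𝓘(ℝ, E) f x (VectorField.mlieBracket 𝓘(ℝ, E) X Y x) =
      mvfderiv 𝓘(ℝ, E) (fun y ↦ mvfderiv 𝓘(ℝ, E) f y (Y y)) x (X x) -
        mvfderiv 𝓘(ℝ, E) (fun y ↦ mvfderiv 𝓘(ℝ, E) f y (X y)) x (Y x) := by
  have hxs : x ∈ (extChartAt 𝓘(ℝ, E) x).source := mem_extChartAt_source x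
  have hφ : MDiffAt (extChartAt 𝓘(ℝ, E) x) x :=
    (contMDiffAt_extChartAt (n := 1)).mdifferentiableAt one_ne_zero
  have hS : (extChartAt 𝓘(ℝ, E) x).symm ⁻¹' Set.univ ∩ Set.range 𝓘(ℝ, E) = Set.univ := by simp
  set X' : E → E := VectorField.mpullbackWithin 𝓘(ℝ, E) 𝓘(ℝ, E) (extChartAt 𝓘(ℝ, E) x).symm X
      (Set.range 𝓘(ℝ, E)) with hX'
  set Y' : E → E := VectorField.mpullbackWithin 𝓘(ℝ, E) 𝓘(ℝ, E) (extChartAt 𝓘(ℝ, E) x).symm Y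
      (Set.range 𝓘(ℝ, E)) with hY'
  set f' : E → W := fun z ↦ f ((extChartAt 𝓘(ℝ, E) x).symm z) with hf'
  have dX' : DifferentiableAt ℝ X' (extChartAt 𝓘(ℝ, E) x x) := by
    rw [← mdifferentiableWithinAt_univ] at hX
    have := hX.differentiableWithinAt_mpullbackWithin_vectorField
    rw [hS] at this
    exact this.differentiableAt Filter.univ_mem
  have dY' : DifferentiableAt ℝ Y' (extChartAt 𝓘(ℝ, E) x x) := by
    rw [← mdifferentiableWithinAt_univ] at hY
    have := hY.differentiableWithinAt_mpullbackWithin_vectorField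
    rw [hS] at this
    exact this.differentiableAt Filter.univ_mem
  have cf' : ContDiffAt ℝ ∞ f' (extChartAt 𝓘(ℝ, E) x x) := by
    have h2 := (contMDiffAt_iff.1 hf).2
    rw [show Set.range 𝓘(ℝ, E) = Set.univ by simp] at h2
    exact h2.contDiffAt Filter.univ_mem
  have df : ∀ᶠ y in nhds x, MDiffAt f y := by
    have h2 := (contMDiffAt_iff_contMDiffAt_nhds (n := 1) (by simp)).1 (hf.of_le (by simp))
    exact h2.mono fun y hy ↦ hy.mdifferentiableAt one_ne_zero
  have chain (Z : VField E M) (dZ : DifferentiableAt ℝ (VectorField.mpullbackWithin 𝓘(ℝ, E)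
      𝓘(ℝ, E) (extChartAt 𝓘(ℝ, E) x).symm Z (Set.range 𝓘(ℝ, E)) : E → E)
      (extChartAt 𝓘(ℝ, E) x x)) (u : TangentSpace 𝓘(ℝ, E) x) :
      mvfderiv 𝓘(ℝ, E) (fun y ↦ mvfderiv 𝓘(ℝ, E) f y (Z y)) x u =
        fderiv ℝ (fun z ↦ fderiv ℝ f' z ((VectorField.mpullbackWithin 𝓘(ℝ, E)
          𝓘(ℝ, E) (extChartAt 𝓘(ℝ, E) x).symm Z (Set.range 𝓘(ℝ, E)) : E → E) z))
          (extChartAt 𝓘(ℝ, E) x x) (mvfderiv 𝓘(ℝ, E) (extChartAt 𝓘(ℝ, E) x) x u) := by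
    rw [← mvfderiv_comp_fderiv _ hφ]
    · refine mvfderiv_congr ?_ u
      filter_upwards [df, extChartAt_source_mem_nhds (I := 𝓘(ℝ, E)) x] with y hy hys
      rw [mvfderiv_eq_fderiv_writtenInChart hy hys, mpullbackWithin_extChartAt_symm_apply Z hys]
    · exact ((cf'.fderiv_right (m := 1) (by norm_cast)).differentiableAt one_ne_zero).clm_apply dZ
  rw [chain X dX', chain Y dY', mvfderiv_eq_fderiv_writtenInChart df.self_of_nhds hxs,
    ← mpullbackWithin_extChartAt_symm_apply X hxs, ← mpullbackWithin_extChartAt_symm_apply Y hxs]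
  rw [← VectorField.fderiv_apply_lieBracket (n := ∞) cf' (by simpa using ENat.LEInfty.out) dY' dX']
  congr 1
  -- The manifold bracket is the pullback of the bracket in the chart, so the differential of the
  -- chart undoes the inverse in that pullback.
  have hinv := isInvertible_mfderiv_extChartAt (I := 𝓘(ℝ, E)) hxs
  have h3 := hinv.self_apply_inverse (VectorField.lieBracketWithin ℝ (E := E) X' Y'
    ((extChartAt 𝓘(ℝ, E) x).symm ⁻¹' Set.univ ∩ Set.range 𝓘(ℝ, E)) (extChartAt 𝓘(ℝ, E) x x) : E)
  refine Eq.trans h3 ?_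
  rw [hS, VectorField.lieBracketWithin_univ]

end Derivations

/-! ### The inverse function theorem on an open set -/

section InverseFunction

variable {V W : Type*} [NormedAddCommGroup V] [NormedSpace ℝ V] [CompleteSpace V]
  [NormedAddCommGroup W] [NormedSpace ℝ W]

/-- The inverse function theorem, with smoothness on the whole domain of the local inverse. -/
theorem exists_openPartialHomeomorph_of_contDiffOn {g : V → W} {U : Set V} (hU : IsOpen U)
    (hg : ContDiffOn ℝ ∞ g U) {a : V} (ha : a ∈ U) (hi : (fderiv ℝ g a).IsInvertible) :
    ∃ Φ : OpenPartialHomeomorph V W, ⇑Φ = g ∧ a ∈ Φ.source ∧ Φ.source ⊆ U ∧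
      ContDiffOn ℝ ∞ Φ.symm Φ.target ∧ ∀ x ∈ Φ.source, (fderiv ℝ g x).IsInvertible := by
  obtain ⟨g', hg'⟩ := hi
  have hga := hg.contDiffAt (hU.mem_nhds ha)
  have hd : HasFDerivAt g (g' : V →L[ℝ] W) a := by
    rw [hg']
    exact (hga.differentiableAt (by simp)).hasFDerivAt
  -- Invertibility of the derivative is an open condition; restricting to it makes the local inverse
  -- smooth at every point of its domain, not just near `g a`.
  have hopen : IsOpen (U ∩ fderiv ℝ g ⁻¹' Set.range ((↑) : (V ≃L[ℝ] W) → V →L[ℝ] W)) :=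
    (hg.continuousOn_fderiv_of_isOpen hU (by simp)).isOpen_inter_preimage hU
      ContinuousLinearEquiv.isOpen
  refine ⟨(hga.toOpenPartialHomeomorph g hd (by simp)).restrOpen _ hopen, rfl, ?_, ?_, ?_, ?_⟩
  · exact ⟨hga.mem_toOpenPartialHomeomorph_source hd (by simp), ha, g', hg'⟩
  · exact fun x hx ↦ hx.2.1
  · intro y hy
    obtain ⟨-, hyU, f', hf'⟩ := OpenPartialHomeomorph.map_target _ hy
    have hc := hg.contDiffAt (hU.mem_nhds hyU)
    refine (OpenPartialHomeomorph.contDiffAt_symm _ (f₀' := f') hy ?_ hc).contDiffWithinAt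
    rw [hf']
    exact (hc.differentiableAt (by simp)).hasFDerivAt
  · exact fun x hx ↦ hx.2.2

end InverseFunction

/-! ### Smoothness of superposition operators on `C(K, V)` -/

section Superposition

variable {K : Type*} [TopologicalSpace K] [CompactSpace K]
  {V W : Type*} [NormedAddCommGroup V] [NormedSpace ℝ V] [NormedAddCommGroup W] [NormedSpace ℝ W]

set_option synthInstance.maxHeartbeats 200000 in
/-- Pointwise application of a continuous family of operators, as a bounded bilinear map. -/
def pointwiseApply (K V W : Type*) [TopologicalSpace K] [CompactSpace K]
    [NormedAddCommGroup V] [NormedSpace ℝ V] [NormedAddCommGroup W] [NormedSpace ℝ W] :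
    C(K, V →L[ℝ] W) →L[ℝ] C(K, V) →L[ℝ] C(K, W) :=
  LinearMap.mkContinuous₂
    (LinearMap.mk₂ ℝ (fun (L : C(K, V →L[ℝ] W)) (h : C(K, V)) ↦
      (⟨fun k ↦ L k (h k), L.continuous.clm_apply h.continuous⟩ : C(K, W)))
      (by intros; ext; simp) (by intros; ext; simp) (by intros; ext; simp) (by intros; ext; simp))
    1 (fun L h ↦ by
      rw [one_mul, ContinuousMap.norm_le _ (by positivity)]
      exact fun k ↦ (L k).le_of_opNorm_le_of_le (L.norm_coe_le_norm k) (h.norm_coe_le_norm k))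

@[simp] theorem pointwiseApply_apply (L : C(K, V →L[ℝ] W)) (h : C(K, V)) (k : K) :
    pointwiseApply K V W L h k = L k (h k) := rfl

/-- The superposition operator `u ↦ A ∘ u` on continuous maps. -/
def superposition (K : Type*) [TopologicalSpace K] (A : V → W) (hA : Continuous A) (u : C(K, V)) :
    C(K, W) :=
  (⟨A, hA⟩ : C(V, W)).comp u

@[simp] theorem superposition_apply (A : V → W) (hA : Continuous A) (u : C(K, V)) (k : K) :
    superposition K A hA u k = A (u k) := rfl

theorem hasFDerivAt_superposition {A : V → W} (hA : ContDiff ℝ 1 A) (u : C(K, V)) :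
    HasFDerivAt (superposition K A hA.continuous)
      (pointwiseApply K V W (superposition K (fderiv ℝ A) (hA.continuous_fderiv one_ne_zero) u))
      u := by
  rw [hasFDerivAt_iff_isLittleO_nhds_zero, Asymptotics.isLittleO_iff]
  intro ε hε
  have hc : IsCompact (Set.range u) := isCompact_range u.continuous
  have := hc.uniformContinuousAt_of_continuousAt (fderiv ℝ A)
    (fun a _ ↦ (hA.continuous_fderiv one_ne_zero).continuousAt) (Metric.dist_mem_uniformity hε)
  obtain ⟨δ, hδ, H⟩ := Metric.mem_uniformity_dist.1 this
  filter_upwards [Metric.ball_mem_nhds (0 : C(K, V)) hδ] with h hh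
  rw [mem_ball_zero_iff] at hh
  rw [ContinuousMap.norm_le _ (by positivity)]
  intro k
  have hk : ‖h k‖ < δ := (h.norm_coe_le_norm k).trans_lt hh
  -- Mean value inequality for `A` minus its linearisation at `u k`. The radius `δ` is uniform in
  -- `k` because the range of `u` is compact.
  have key := (convex_ball (u k) δ).norm_image_sub_le_of_norm_fderiv_le' (f := A)
    (φ := fderiv ℝ A (u k)) (C := ε) (x := u k) (y := u k + h k)
    (fun z _ ↦ (hA.differentiable one_ne_zero) z) (fun z hz ↦ ?_) (Metric.mem_ball_self hδ)
    (by simpa using hk)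
  · simp only [add_sub_cancel_left] at key
    exact key.trans (mul_le_mul_of_nonneg_left (h.norm_coe_le_norm k) hε.le)
  · have := H (a := u k) (b := z) (by rw [dist_comm]; exact hz) ⟨k, rfl⟩
    rw [← dist_eq_norm, dist_comm]
    exact le_of_lt this

set_option synthInstance.maxHeartbeats 200000 in
-- The derivative is the superposition operator of `fderiv ℝ A` followed by a bounded linear map, so
-- one can induct on the order. The target `W` is quantified inside the induction since it changes
-- to `V →L[ℝ] W`; both spaces share a universe so that this type is again admissible.
theorem contDiff_superposition_nat {V : Type u} [NormedAddCommGroup V] [NormedSpace ℝ V] (n : ℕ) :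
    ∀ {W : Type u} [NormedAddCommGroup W] [NormedSpace ℝ W]
    {A : V → W} (hA : ContDiff ℝ ∞ A), ContDiff ℝ n (superposition K A hA.continuous) := by
  induction n with
  | zero =>
    intro W _ _ A hA
    exact contDiff_zero.2 (ContinuousMap.continuous_postcomp _)
  | succ n ih =>
    intro W _ _ A hA
    have hd := hasFDerivAt_superposition (K := K) (hA.of_le (n := ∞) (m := 1) ENat.LEInfty.out)
    rw [Nat.cast_succ, contDiff_succ_iff_hasFDerivAt]
    refine ⟨_, ?_, hd⟩
    exact (pointwiseApply K V W).contDiff.comp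
      (ih (A := fderiv ℝ A) (hA.fderiv_right (m := ∞) (by simp)))

theorem contDiff_superposition {V : Type u} [NormedAddCommGroup V] [NormedSpace ℝ V]
    {W : Type u} [NormedAddCommGroup W] [NormedSpace ℝ W]
    {A : V → W} (hA : ContDiff ℝ ∞ A) : ContDiff ℝ ∞ (superposition K A hA.continuous) :=
  contDiff_infty.2 fun n ↦ contDiff_superposition_nat n hA

end Superposition

/-! ### The ray equation and its variation -/

section Frobenius

open Set unitInterval

/-- Integration from `0`, as an operator on curves. -/
def integralOp (W : Type*) [NormedAddCommGroup W] [NormedSpace ℝ W] : C(I, W) →L[ℝ] C(I, W) :=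
  LinearMap.mkContinuous
    { toFun := fun u ↦ ⟨fun t ↦ ∫ s in (0 : ℝ)..t, IccExtend zero_le_one u s, by
        have h : Continuous (IccExtend zero_le_one u) := u.continuous.Icc_extend'
        exact (intervalIntegral.continuous_primitive
          (fun a b ↦ h.intervalIntegrable a b) 0).comp continuous_subtype_val⟩
      map_add' := fun u v ↦ by
        ext t
        have hu : Continuous (IccExtend zero_le_one u) := u.continuous.Icc_extend'
        have hv : Continuous (IccExtend zero_le_one v) := v.continuous.Icc_extend'
        exact intervalIntegral.integral_add (hu.intervalIntegrable _ _) (hv.intervalIntegrable _ _)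
      map_smul' := fun c u ↦ by
        ext t
        exact intervalIntegral.integral_smul c _ }
    1 (fun u ↦ by
      rw [one_mul, ContinuousMap.norm_le _ (by positivity)]
      intro t
      refine (intervalIntegral.norm_integral_le_of_norm_le_const (C := ‖u‖)
        fun s _ ↦ u.norm_coe_le_norm _).trans ?_
      rw [sub_zero, abs_of_nonneg t.2.1]
      exact mul_le_of_le_one_right (norm_nonneg _) t.2.2)

variable {W₁ W₂ : Type u} [NormedAddCommGroup W₁] [NormedSpace ℝ W₁]
  [NormedAddCommGroup W₂] [NormedSpace ℝ W₂]

/-- The linear map sending a curve `u` and a vector `y` to the curve `s ↦ ((u s, s • y), y)`. -/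
def rayCurve (W₁ W₂ : Type*) [NormedAddCommGroup W₁] [NormedSpace ℝ W₁]
    [NormedAddCommGroup W₂] [NormedSpace ℝ W₂] :
    C(I, W₁) × W₂ →L[ℝ] C(I, (W₁ × W₂) × W₂) :=
  LinearMap.mkContinuous
    { toFun := fun p ↦ ⟨fun s ↦ ((p.1 s, (s : ℝ) • p.2), p.2), by fun_prop⟩
      map_add' := fun p q ↦ by ext <;> simp
      map_smul' := fun c p ↦ by
        ext s
        · rfl
        · exact smul_comm _ _ _
        · rfl }
    1 (fun p ↦ by
      rw [one_mul, ContinuousMap.norm_le _ (by positivity)]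
      intro s
      have h1 : ‖p.1 s‖ ≤ ‖p‖ := (p.1.norm_coe_le_norm s).trans (norm_fst_le p)
      have h2 : ‖p.2‖ ≤ ‖p‖ := norm_snd_le p
      have h3 : ‖(s : ℝ) • p.2‖ ≤ ‖p‖ := by
        rw [norm_smul, Real.norm_of_nonneg s.2.1]
        exact (mul_le_of_le_one_left (norm_nonneg _) s.2.2).trans h2
      exact max_le (max_le h1 h3) h2)

@[simp] theorem rayCurve_apply (u : C(I, W₁)) (y : W₂) (s : I) :
    rayCurve W₁ W₂ (u, y) s = ((u s, (s : ℝ) • y), y) := rfl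

/-- The equation `u(t) = v + ∫₀ᵗ A(u(s), s y) y ds` is solved for `u` in `C(I, W₁)` with parameters
`q = (v, y)`. At `q = 0` the integrand vanishes for every `u`, so the linearisation in `u` is the
identity. Scaling by `y` keeps the time interval fixed. -/
theorem exists_smooth_rayFlow [CompleteSpace W₁] [CompleteSpace W₂] {A : W₁ × W₂ → W₂ →L[ℝ] W₁}
    (hA' : ContDiff ℝ ∞ fun p : (W₁ × W₂) × W₂ ↦ A p.1 p.2) :
    ∃ (O : Set (W₁ × W₂)) (U : W₁ × W₂ → C(I, W₁)), IsOpen O ∧ 0 ∈ O ∧ ContDiffOn ℝ ∞ U O ∧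
      U 0 = 0 ∧ ∀ q ∈ O, U q = ContinuousMap.const I q.1 +
        integralOp W₁ (superposition I _ hA'.continuous (rayCurve W₁ W₂ (U q, q.2))) := by
  set N := superposition I _ hA'.continuous with hN
  have hNs : ContDiff ℝ ∞ N := contDiff_superposition hA'
  set c : W₁ →L[ℝ] C(I, W₁) := ContinuousLinearMap.const ℝ I with hc
  set Φ : (W₁ × W₂) × C(I, W₁) → C(I, W₁) := fun p ↦ p.2 - c p.1.1 -
    integralOp W₁ (N (rayCurve W₁ W₂ (p.2, p.1.2))) with hΦ
  have hΦs : ContDiff ℝ ∞ Φ := by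
    have h1 : ContDiff ℝ ∞ fun p : (W₁ × W₂) × C(I, W₁) ↦ (p.2, p.1.2) := by fun_prop
    have h2 := (integralOp W₁).contDiff.comp (hNs.comp ((rayCurve W₁ W₂).contDiff.comp h1))
    refine ContDiff.sub ?_ h2
    exact contDiff_snd.sub (c.contDiff.comp (contDiff_fst.comp contDiff_fst))
  have hN0 (u : C(I, W₁)) : N (rayCurve W₁ W₂ (u, 0)) = 0 := by
    ext s
    simp [hN]
  have hΦ0 (u : C(I, W₁)) : Φ (0, u) = u := by simp [hΦ, hN0]
  -- Adjoining the parameters turns the implicit function problem into an inverse function problem;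
  -- solutions are the points of `Θ⁻¹(q, 0)`.
  set Θ : (W₁ × W₂) × C(I, W₁) → (W₁ × W₂) × C(I, W₁) := fun p ↦ (p.1, Φ p) with hΘ
  have hΘs : ContDiff ℝ ∞ Θ := contDiff_fst.prodMk hΦs
  have hinv : (fderiv ℝ Θ 0).IsInvertible := by
    set L := fderiv ℝ Φ 0 with hL
    have hd : DifferentiableAt ℝ Φ 0 := hΦs.differentiable (by simp) 0
    have h1 : fderiv ℝ Θ 0 = (ContinuousLinearMap.fst ℝ _ _).prod L :=
      ((hasFDerivAt_fst).prodMk hd.hasFDerivAt).fderiv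
    have h2 (u : C(I, W₁)) : L (0, u) = u := by
      have h3 : HasFDerivAt (fun u : C(I, W₁) ↦ Φ (0, u))
          (L.comp (ContinuousLinearMap.inr ℝ (W₁ × W₂) C(I, W₁))) 0 :=
        HasFDerivAt.comp (f := fun u : C(I, W₁) ↦ ((0 : W₁ × W₂), u)) (0 : C(I, W₁))
          hd.hasFDerivAt (ContinuousLinearMap.inr ℝ (W₁ × W₂) C(I, W₁)).hasFDerivAt
      simp only [hΦ0] at h3
      exact congrArg (fun T ↦ T u) (h3.unique (hasFDerivAt_id _))
    rw [h1]
    -- The derivative is block triangular, `(q, u) ↦ (q, L(q, 0) + u)`, so its inverse subtracts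
    -- `L(q, 0)`.
    refine ContinuousLinearMap.IsInvertible.of_inverse
      (g := (ContinuousLinearMap.fst ℝ _ _).prod ((ContinuousLinearMap.snd ℝ _ _) -
        L.comp ((ContinuousLinearMap.fst ℝ _ _).prod 0))) ?_ ?_
    · refine ContinuousLinearMap.ext fun p ↦ Prod.ext rfl ?_
      have h4 : ((p.1, p.2 - L (p.1, 0)) : (W₁ × W₂) × C(I, W₁)) =
        (p.1, 0) + (0, p.2 - L (p.1, 0)) := by simp
      change L (p.1, p.2 - L (p.1, 0)) = p.2
      rw [h4, map_add, h2]
      simp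
    · refine ContinuousLinearMap.ext fun p ↦ Prod.ext rfl ?_
      have h4 : p = (p.1, 0) + (0, p.2) := by simp
      change L p - L (p.1, 0) = p.2
      conv_lhs => rw [h4, map_add, h2]
      simp
  obtain ⟨H, hHΘ, hH0, -, hHs, -⟩ := exists_openPartialHomeomorph_of_contDiffOn isOpen_univ
    hΘs.contDiffOn (mem_univ 0) hinv
  have hΘ0 : Θ 0 = 0 := Prod.ext rfl (hΦ0 0)
  have hH00 : H 0 = 0 := by rw [hHΘ, hΘ0]
  have hj : Continuous fun q : W₁ × W₂ ↦ (q, (0 : C(I, W₁))) := by fun_prop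
  refine ⟨(fun q ↦ (q, 0)) ⁻¹' H.target, fun q ↦ (H.symm (q, 0)).2, H.open_target.preimage hj,
    ?_, ?_, ?_, ?_⟩
  · have := H.map_source hH0
    rwa [hH00] at this
  · refine contDiff_snd.comp_contDiffOn (hHs.comp ?_ fun q hq ↦ hq)
    exact (contDiff_id.prodMk contDiff_const).contDiffOn
  · change (H.symm 0).2 = 0
    have := H.left_inv hH0
    rw [hH00] at this
    rw [this]
    rfl
  · intro q hq
    have h1 := H.right_inv hq
    rw [hHΘ] at h1
    have h2 : (H.symm (q, 0)).1 = q := congrArg Prod.fst h1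
    have h3 : Φ (H.symm (q, 0)) = 0 := congrArg Prod.snd h1
    simp only [hΦ, h2] at h3
    rw [sub_sub, sub_eq_zero] at h3
    exact h3

set_option synthInstance.maxHeartbeats 200000 in
-- The variation of the ray solution in direction `η` and the curve `t ↦ A(û t, t y)(t η)` both
-- vanish at `0` and solve the same affine ODE, the second one by integrability. Hence they agree at
-- `t = 1`.
theorem fderiv_rayFlow_apply {A : W₁ × W₂ → W₂ →L[ℝ] W₁} [CompleteSpace W₁]
    (hA : ContDiff ℝ ∞ A) (hA' : ContDiff ℝ ∞ fun p : (W₁ × W₂) × W₂ ↦ A p.1 p.2)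
    {Ω : Set (W₁ × W₂)} (hint : ∀ z ∈ Ω, ∀ y η,
      fderiv ℝ A z (A z y, y) η = fderiv ℝ A z (A z η, η) y)
    {U : W₁ × W₂ → C(I, W₁)} {q : W₁ × W₂} (hU : DifferentiableAt ℝ U q)
    (hUq : ∀ᶠ q in nhds q, U q = ContinuousMap.const I q.1 +
        integralOp W₁ (superposition I _ hA'.continuous (rayCurve W₁ W₂ (U q, q.2))))
    (hΩ : ∀ t : I, (U q t, (t : ℝ) • q.2) ∈ Ω) (η : W₂) :
    fderiv ℝ U q (0, η) 1 = A (U q 1, q.2) η := by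
  set u := U q with hu
  set y := q.2 with hy
  set B : (W₁ × W₂) × W₂ → W₁ := fun p ↦ A p.1 p.2 with hB
  have dA : Differentiable ℝ A := hA.differentiable (by simp)
  have fB (z : W₁ × W₂) (y η : W₂) (h : W₁ × W₂) :
      fderiv ℝ B (z, y) (h, η) = fderiv ℝ A z h y + A z η := by
    have h1 : HasFDerivAt (fun p : (W₁ × W₂) × W₂ ↦ A p.1)
        ((fderiv ℝ A z).comp (ContinuousLinearMap.fst ℝ _ _)) (z, y) :=
      HasFDerivAt.comp (z, y) (dA z).hasFDerivAt hasFDerivAt_fst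
    rw [(h1.clm_apply hasFDerivAt_snd).fderiv]
    simp [add_comm]
  set N := superposition I B hA'.continuous with hN
  set ξ := fderiv ℝ U q (0, η) with hξ
  set g : C(I, W₁) := pointwiseApply I _ _ (superposition I (fderiv ℝ B)
    ((hA'.of_le (m := 1) ENat.LEInfty.out).continuous_fderiv one_ne_zero)
    (rayCurve W₁ W₂ (u, y))) (rayCurve W₁ W₂ (ξ, η)) with hg
  have hξg : ξ = integralOp W₁ g := by
    have h1 := hasFDerivAt_superposition (K := I) (hA'.of_le (m := 1) ENat.LEInfty.out)
      (rayCurve W₁ W₂ (u, y))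
    have h2 : HasFDerivAt (fun q ↦ rayCurve W₁ W₂ (U q, q.2)) _ q :=
      (rayCurve W₁ W₂).hasFDerivAt.comp q (hU.hasFDerivAt.prodMk hasFDerivAt_snd)
    have h3 := (integralOp W₁).hasFDerivAt.comp q (HasFDerivAt.comp q h1 h2)
    have h4 := ((ContinuousLinearMap.const ℝ I).hasFDerivAt.comp q
      (hasFDerivAt_fst (𝕜 := ℝ) (E := W₁) (F := W₂))).add h3
    have h5 := (h4.congr_of_eventuallyEq hUq).fderiv
    rw [hξ, h5]
    simp [hg, hξ]
  set û : ℝ → W₁ := fun t ↦ q.1 + ∫ s in (0 : ℝ)..t,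
    IccExtend zero_le_one (N (rayCurve W₁ W₂ (u, y))) s with hû
  have hûu (t : I) : û t = u t := by
    have := congrArg (fun v : C(I, W₁) ↦ v t) hUq.self_of_nhds
    exact this.symm
  have dû {t : ℝ} (ht : t ∈ Icc (0 : ℝ) 1) : HasDerivAt û (A (û t, t • y) y) t := by
    have hc : Continuous (IccExtend zero_le_one (N (rayCurve W₁ W₂ (u, y)))) :=
      (N _).continuous.Icc_extend'
    have h1 := (hc.integral_hasStrictDerivAt 0 t).hasDerivAt.const_add q.1
    rw [IccExtend_of_mem zero_le_one _ ht] at h1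
    have h2 := hûu ⟨t, ht⟩
    simp only at h2
    rw [h2]
    exact h1
  -- The right side of the ray equation linearised along `û`: the first term comes from moving the
  -- base point, the second from varying the direction `y`.
  set f : ℝ → W₁ → W₁ := fun t w ↦ fderiv ℝ A (û t, t • y) (w, t • η) y + A (û t, t • y) η with hf
  have cû : Continuous û := by
    have hc : Continuous (IccExtend zero_le_one (N (rayCurve W₁ W₂ (u, y)))) :=
      (N _).continuous.Icc_extend'
    exact continuous_const.add
      (intervalIntegral.continuous_primitive (fun a b ↦ hc.intervalIntegrable a b) 0)
  have cA' : Continuous fun t ↦ fderiv ℝ A (û t, t • y) :=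
    (hA.continuous_fderiv (by simp)).comp (by fun_prop)
  obtain ⟨C, hC⟩ := (isCompact_Icc (a := (0 : ℝ)) (b := 1)).exists_bound_of_continuousOn
    (E := W₁ × W₂ →L[ℝ] W₂ →L[ℝ] W₁) cA'.continuousOn
  have hlip : ∀ t ∈ Ico (0 : ℝ) 1, LipschitzOnWith (Real.toNNReal (C * ‖y‖)) (f t) univ := by
    intro t ht
    refine LipschitzOnWith.of_dist_le_mul fun w _ w' _ ↦ ?_
    have h1 : f t w - f t w' = fderiv ℝ A (û t, t • y) (w - w', 0) y := by
      simp only [hf]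
      rw [add_sub_add_right_eq_sub, ← sub_apply, ← map_sub]
      simp
    rw [dist_eq_norm, h1, dist_eq_norm]
    have h2 : ‖fderiv ℝ A (û t, t • y) (w - w', 0)‖ ≤ C * ‖w - w'‖ := by
      have := (fderiv ℝ A (û t, t • y)).le_of_opNorm_le (hC t ⟨ht.1, ht.2.le⟩) (w - w', 0)
      simpa using this
    calc _ ≤ C * ‖w - w'‖ * ‖y‖ := ContinuousLinearMap.le_of_opNorm_le _ h2 y
      _ = C * ‖y‖ * ‖w - w'‖ := by ring
      _ ≤ _ := by gcongr; exact Real.le_coe_toNNReal _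
  set ξ' : ℝ → W₁ := fun t ↦ ∫ s in (0 : ℝ)..t, IccExtend zero_le_one g s with hξ'
  have hξξ' (t : I) : ξ' t = ξ t := by
    rw [hξg]
    rfl
  have cg : Continuous (IccExtend zero_le_one g) := g.continuous.Icc_extend'
  have dξ' {t : ℝ} (ht : t ∈ Icc (0 : ℝ) 1) : HasDerivAt ξ' (f t (ξ' t)) t := by
    have h1 := (cg.integral_hasStrictDerivAt 0 t).hasDerivAt
    rw [IccExtend_of_mem zero_le_one _ ht] at h1
    have h2 := hûu ⟨t, ht⟩
    have h3 := hξξ' ⟨t, ht⟩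
    simp only at h2 h3
    simp only [hf]
    rw [h2, h3, ← fB]
    exact h1
  set ζ : ℝ → W₁ := fun t ↦ A (û t, t • y) (t • η) with hζ
  have dζ {t : ℝ} (ht : t ∈ Icc (0 : ℝ) 1) : HasDerivAt ζ (f t (ζ t)) t := by
    have h0 : HasDerivAt (fun t : ℝ ↦ t • y) y t := by simpa using (hasDerivAt_id t).smul_const y
    have h0' : HasDerivAt (fun t : ℝ ↦ t • η) η t := by simpa using (hasDerivAt_id t).smul_const η
    have h1 := (dA (û t, t • y)).hasFDerivAt.comp_hasDerivAt t ((dû ht).prodMk h0)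
    have h2 := h1.clm_apply h0'
    refine h2.congr_deriv ?_
    have h3 : (û t, t • y) ∈ Ω := by
      have := hΩ ⟨t, ht⟩
      rw [← hûu] at this
      exact this
    simp only [hf, hζ, map_smul, Function.comp_apply]
    -- Integrability exchanges `y` and `η`: differentiating `ζ` yields the derivative of `A` along
    -- `(A y, y)` applied to `t η`, while `f` needs it along `(A (t η), t η)` applied to `y`.
    rw [hint _ h3, ← smul_apply, ← map_smul]
    simp
  have key := ODE_solution_unique_of_mem_Icc_right (v := f) (s := fun _ ↦ univ) (f := ξ') (g := ζ)
    (a := 0) (b := 1) hlip (fun t ht ↦ (dξ' ht).continuousAt.continuousWithinAt)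
    (fun t ht ↦ (dξ' ⟨ht.1, ht.2.le⟩).hasDerivWithinAt) (fun _ _ ↦ mem_univ _)
    (fun t ht ↦ (dζ ht).continuousAt.continuousWithinAt)
    (fun t ht ↦ (dζ ⟨ht.1, ht.2.le⟩).hasDerivWithinAt) (fun _ _ ↦ mem_univ _)
    (by simp [hξ', hζ])
  have h1 : ξ' 1 = ζ 1 := key ⟨zero_le_one, le_rfl⟩
  have h2 := hξξ' 1
  have h3 := hûu 1
  simp only [Icc.coe_one] at h2 h3
  rw [← h2, h1, ← h3]
  simp [hζ]

end Frobenius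

/-! ### Frobenius' theorem for graphs -/

section Frobenius

open Set unitInterval

variable {W₁ W₂ : Type u} [NormedAddCommGroup W₁] [NormedSpace ℝ W₁]
  [NormedAddCommGroup W₂] [NormedSpace ℝ W₂]

/-- `Ψ(v, y)` follows the ray solution from `v` up to time `1`. Its differential sends `(0, η)` into
the graph of `A`, and `Ψ(v, 0) = v`, so at the origin the differential is triangular and invertible.
-/
theorem exists_straightening_of_contDiff [CompleteSpace W₁] [CompleteSpace W₂]
    {A : W₁ × W₂ → W₂ →L[ℝ] W₁} (hA : ContDiff ℝ ∞ A) {r : ℝ} (hr : 0 < r)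
    (hint : ∀ z ∈ Metric.ball (0 : W₁ × W₂) r, ∀ y η,
      fderiv ℝ A z (A z y, y) η = fderiv ℝ A z (A z η, η) y) :
    ∃ Ψ : OpenPartialHomeomorph (W₁ × W₂) (W₁ × W₂), 0 ∈ Ψ.source ∧ Ψ 0 = 0 ∧
      Ψ.target ⊆ Metric.ball 0 r ∧ ContDiffOn ℝ ∞ Ψ Ψ.source ∧ ContDiffOn ℝ ∞ Ψ.symm Ψ.target ∧
      (∀ q ∈ Ψ.source, (Ψ q).2 = q.2) ∧
      ∀ q ∈ Ψ.source, ∀ η, fderiv ℝ Ψ q (0, η) = (A (Ψ q) η, η) := by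
  have hA' : ContDiff ℝ ∞ fun p : (W₁ × W₂) × W₂ ↦ A p.1 p.2 :=
    (hA.comp contDiff_fst).clm_apply contDiff_snd
  obtain ⟨O, U, hO, h0O, hU, hU0, hUq⟩ := exists_smooth_rayFlow hA'
  -- Bounding both `U q` and `q` by `r` keeps the entire lifted ray inside the ball on which
  -- integrability is known.
  set O' := (O ∩ U ⁻¹' Metric.ball 0 r) ∩ Metric.ball 0 r with hO'
  have hO'o : IsOpen O' :=
    (hU.continuousOn.isOpen_inter_preimage hO Metric.isOpen_ball).inter Metric.isOpen_ball
  have h0O' : (0 : W₁ × W₂) ∈ O' := by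
    refine ⟨⟨h0O, ?_⟩, Metric.mem_ball_self hr⟩
    rw [mem_preimage, hU0]
    exact Metric.mem_ball_self hr
  have hmem {q : W₁ × W₂} (hq : q ∈ O') (t : I) :
      (U q t, (t : ℝ) • q.2) ∈ Metric.ball (0 : W₁ × W₂) r := by
    have h1 : ‖U q‖ < r := by simpa using hq.1.2
    have h2 : ‖q‖ < r := by simpa using hq.2
    rw [mem_ball_zero_iff]
    refine max_lt (((U q).norm_coe_le_norm t).trans_lt h1) ?_
    rw [norm_smul, Real.norm_of_nonneg t.2.1]
    exact ((mul_le_of_le_one_left (norm_nonneg _) t.2.2).trans (norm_snd_le q)).trans_lt h2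
  set ev : C(I, W₁) →L[ℝ] W₁ := ContinuousMap.evalCLM ℝ (1 : I) with hev
  set Ψ : W₁ × W₂ → W₁ × W₂ := fun q ↦ (U q 1, q.2) with hΨ
  have hΨs : ContDiffOn ℝ ∞ Ψ O' :=
    (ev.contDiff.comp_contDiffOn (hU.mono fun q hq ↦ hq.1.1)).prodMk contDiff_snd.contDiffOn
  have dΨ {q : W₁ × W₂} (hq : q ∈ O') (h : W₁ × W₂) :
      fderiv ℝ Ψ q h = (fderiv ℝ U q h 1, h.2) := by
    have h1 : DifferentiableAt ℝ U q :=
      (hU.contDiffAt (hO.mem_nhds hq.1.1)).differentiableAt (by simp)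
    have h2 := (ev.hasFDerivAt.comp q h1.hasFDerivAt).prodMk (hasFDerivAt_snd (𝕜 := ℝ) (p := q))
    have h3 : fderiv ℝ Ψ q = _ := h2.fderiv
    rw [h3]
    rfl
  have dη {q : W₁ × W₂} (hq : q ∈ O') (η : W₂) : fderiv ℝ Ψ q (0, η) = (A (Ψ q) η, η) := by
    rw [dΨ hq, fderiv_rayFlow_apply hA hA' hint
      ((hU.contDiffAt (hO.mem_nhds hq.1.1)).differentiableAt (by simp)) _ (hmem hq)]
    exact Filter.mem_of_superset (hO.mem_nhds hq.1.1) hUq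
  have hΨv {v : W₁} (hv : (v, (0 : W₂)) ∈ O) : U (v, 0) = ContinuousMap.const I v := by
    rw [hUq _ hv]
    have : superposition I (fun p : (W₁ × W₂) × W₂ ↦ A p.1 p.2) hA'.continuous
        (rayCurve W₁ W₂ (U (v, 0), 0)) = 0 := by
      ext s
      simp
    simp [this]
  have hΨ0 : Ψ 0 = 0 := by simp [hΨ, hU0]
  have dξ (ξ : W₁) : fderiv ℝ Ψ 0 (ξ, 0) = (ξ, 0) := by
    have h1 : HasFDerivAt (fun v : W₁ ↦ Ψ (v, 0))
        ((fderiv ℝ Ψ 0).comp (ContinuousLinearMap.inl ℝ W₁ W₂)) 0 := by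
      have hd : HasFDerivAt Ψ (fderiv ℝ Ψ 0) (ContinuousLinearMap.inl ℝ W₁ W₂ 0) :=
        ((hΨs.contDiffAt (hO'o.mem_nhds h0O')).differentiableAt (by simp)).hasFDerivAt
      exact hd.comp (0 : W₁) (ContinuousLinearMap.inl ℝ W₁ W₂).hasFDerivAt
    have h2 : (fun v : W₁ ↦ Ψ (v, 0)) =ᶠ[nhds 0] fun v ↦ (v, 0) := by
      have : ∀ᶠ v : W₁ in nhds 0, (v, (0 : W₂)) ∈ O :=
        (hO.preimage (by fun_prop : Continuous fun v : W₁ ↦ (v, (0 : W₂)))).mem_nhds h0O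
      filter_upwards [this] with v hv
      simp [hΨ, hΨv hv]
    have h3 := h1.unique ((ContinuousLinearMap.inl ℝ W₁ W₂).hasFDerivAt.congr_of_eventuallyEq h2)
    exact congrArg (fun T ↦ T ξ) h3
  have hinv : (fderiv ℝ Ψ 0).IsInvertible := by
    have hsplit (p : W₁ × W₂) : fderiv ℝ Ψ 0 p = (p.1 + A 0 p.2, p.2) := by
      have h1 : p = (p.1, 0) + (0, p.2) := by simp
      conv_lhs => rw [h1, map_add, dξ, dη h0O', hΨ0]
      simp
    refine ContinuousLinearMap.IsInvertible.of_inverse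
      (g := (ContinuousLinearMap.fst ℝ W₁ W₂ - (A 0).comp (ContinuousLinearMap.snd ℝ W₁ W₂)).prod
        (ContinuousLinearMap.snd ℝ W₁ W₂)) ?_ ?_
    · refine ContinuousLinearMap.ext fun p ↦ ?_
      rw [ContinuousLinearMap.comp_apply, hsplit]
      simp
    · refine ContinuousLinearMap.ext fun p ↦ ?_
      rw [ContinuousLinearMap.comp_apply, hsplit]
      simp
  obtain ⟨H, hH, h0H, hHO, hHs, -⟩ := exists_openPartialHomeomorph_of_contDiffOn hO'o hΨs h0O' hinv
  refine ⟨H, h0H, by rw [hH, hΨ0], ?_, ?_, hHs, ?_, ?_⟩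
  · intro z hz
    have h1 := hmem (hHO (H.map_target hz)) 1
    have h2 := H.right_inv hz
    rw [hH] at h2
    rw [← h2]
    simpa [hΨ] using h1
  · rw [hH]
    exact hΨs.mono hHO
  · intro q _
    rw [hH]
  · intro q hq η
    rw [hH]
    exact dη (hHO hq) η

/-- Frobenius' theorem: a smooth involutive distribution given as the graph of `A` over `W₂` can be
straightened by a local diffeomorphism preserving the `W₂`-coordinate. -/
theorem exists_straightening [FiniteDimensional ℝ W₁] [FiniteDimensional ℝ W₂]
    {A : W₁ × W₂ → W₂ →L[ℝ] W₁} {Ω : Set (W₁ × W₂)} (hΩ : IsOpen Ω) (h0 : 0 ∈ Ω)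
    (hA : ContDiffOn ℝ ∞ A Ω)
    (hint : ∀ z ∈ Ω, ∀ y η, fderiv ℝ A z (A z y, y) η = fderiv ℝ A z (A z η, η) y) :
    ∃ Ψ : OpenPartialHomeomorph (W₁ × W₂) (W₁ × W₂), 0 ∈ Ψ.source ∧ Ψ 0 = 0 ∧
      Ψ.target ⊆ Ω ∧ ContDiffOn ℝ ∞ Ψ Ψ.source ∧ ContDiffOn ℝ ∞ Ψ.symm Ψ.target ∧
      (∀ q ∈ Ψ.source, (Ψ q).2 = q.2) ∧
      ∀ q ∈ Ψ.source, ∀ η, fderiv ℝ Ψ q (0, η) = (A (Ψ q) η, η) := by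
  have : CompleteSpace W₁ := FiniteDimensional.complete ℝ W₁
  have : CompleteSpace W₂ := FiniteDimensional.complete ℝ W₂
  obtain ⟨R, hR, hRΩ⟩ := Metric.isOpen_iff.1 hΩ 0 h0
  -- The cutoff makes `A` globally smooth: its support is the closed ball of radius `R / 2`, inside
  -- `Ω`, and it equals `1` on the ball of radius `R / 4`, where integrability therefore survives.
  let χ : ContDiffBump (0 : W₁ × W₂) := ⟨R / 4, R / 2, by positivity, by linarith⟩
  have hsub : Metric.ball (0 : W₁ × W₂) (R / 4) ⊆ Ω :=
    (Metric.ball_subset_ball (by linarith)).trans hRΩ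
  have hA' : ContDiff ℝ ∞ fun z ↦ χ z • A z := by
    rw [contDiff_iff_contDiffAt]
    intro z
    by_cases hz : z ∈ Ω
    · exact (χ.contDiff.contDiffAt).smul (hA.contDiffAt (hΩ.mem_nhds hz))
    · have hz' : z ∈ (tsupport χ)ᶜ := by
        rw [χ.tsupport_eq]
        exact fun h ↦ hz (hRΩ (Metric.closedBall_subset_ball (by simp [χ]; linarith) h))
      refine (contDiffAt_const (c := (0 : W₂ →L[ℝ] W₁))).congr_of_eventuallyEq ?_
      filter_upwards [(isClosed_tsupport χ).isOpen_compl.mem_nhds hz'] with w hw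
      rw [image_eq_zero_of_notMem_tsupport hw, zero_smul]
  have heq {z : W₁ × W₂} (hz : z ∈ Metric.ball (0 : W₁ × W₂) (R / 4)) : χ z • A z = A z := by
    rw [χ.one_of_mem_closedBall (Metric.ball_subset_closedBall hz), one_smul]
  have hfd {z : W₁ × W₂} (hz : z ∈ Metric.ball (0 : W₁ × W₂) (R / 4)) :
      fderiv ℝ (fun z ↦ χ z • A z) z = fderiv ℝ A z := by
    refine Filter.EventuallyEq.fderiv_eq ?_
    filter_upwards [Metric.isOpen_ball.mem_nhds hz] with w hw
    exact heq hw
  obtain ⟨Ψ, h1, h2, h3, h4, h5, h6, h7⟩ := exists_straightening_of_contDiff hA'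
    (r := R / 4) (by linarith) (fun z hz y η ↦ by
      rw [hfd hz, heq hz]
      exact hint z (hsub hz) y η)
  refine ⟨Ψ, h1, h2, h3.trans hsub, h4, h5, h6, fun q hq η ↦ ?_⟩
  rw [h7 q hq, heq (h3 (Ψ.map_source hq))]

end Frobenius

/-! ### Smoothness detected by inner products -/

section Gram

variable {E : Type*} [NormedAddCommGroup E] [NormedSpace ℝ E] [FiniteDimensional ℝ E]
  {M : Type*} [TopologicalSpace M] [ChartedSpace E M] [IsManifold 𝓘(ℝ, E) ∞ M]

theorem contMDiffAt_of_clm_apply_eq {V : Type*} [NormedAddCommGroup V] [NormedSpace ℝ V]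
    [FiniteDimensional ℝ V] {T : M → V →L[ℝ] V} {c b : M → V} {x : M}
    (hT : ContMDiffAt 𝓘(ℝ, E) 𝓘(ℝ, V →L[ℝ] V) ∞ T x) (hb : ContMDiffAt 𝓘(ℝ, E) 𝓘(ℝ, V) ∞ b x)
    (hinj : ∀ᶠ y in nhds x, Function.Injective (T y)) (h : ∀ᶠ y in nhds x, T y (c y) = b y) :
    ContMDiffAt 𝓘(ℝ, E) 𝓘(ℝ, V) ∞ c x := by
  have hinv {y : M} (hy : Function.Injective (T y)) : ∃ e : V ≃L[ℝ] V, (e : V →L[ℝ] V) = T y :=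
    ⟨(LinearEquiv.ofInjectiveEndo (T y).toLinearMap hy).toContinuousLinearEquiv, by ext; rfl⟩
  have : CompleteSpace V := FiniteDimensional.complete ℝ V
  obtain ⟨e, he⟩ := hinv hinj.self_of_nhds
  have h1 : ContDiffAt ℝ ∞ ContinuousLinearMap.inverse (T x) := by
    rw [← he]
    exact contDiffAt_map_inverse e
  have h2 : ContMDiffAt 𝓘(ℝ, E) 𝓘(ℝ, V →L[ℝ] V) ∞ (fun y ↦ (T y).inverse) x :=
    h1.contMDiffAt.comp x hT
  refine (h2.clm_apply hb).congr_of_eventuallyEq ?_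
  filter_upwards [hinj, h] with y hy hyb
  obtain ⟨e, he⟩ := hinv hy
  rw [← hyb, ← he]
  simp

variable [RiemannianBundle (fun x : M ↦ TangentSpace 𝓘(ℝ, E) x)]
    [IsContMDiffRiemannianBundle 𝓘(ℝ, E) ∞ E (fun x : M ↦ TangentSpace 𝓘(ℝ, E) x)]

/-- A vector field with smooth inner products against all smooth fields is smooth. -/
theorem contMDiffAt_of_inner {Y : VField E M} {x : M}
    (h : ∀ Z : VField E M, CMDiffAt ∞ (T% Z) x →
      ContMDiffAt 𝓘(ℝ, E) 𝓘(ℝ) ∞ (fun y ↦ (inner ℝ (Y y) (Z y) : ℝ)) x) :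
    CMDiffAt ∞ (T% Y) x := by
  classical
  let t := trivializationAt E (fun x : M ↦ TangentSpace 𝓘(ℝ, E) x) x
  have hx : x ∈ t.baseSet := FiberBundle.mem_baseSet_trivializationAt E _ x
  let n := Module.finrank ℝ E
  let b : Module.Basis (Fin n) ℝ E := Module.finBasis ℝ E
  let s := t.localFrame b
  let c := t.localFrameCoeff 𝓘(ℝ, E) b
  have hs (i) : CMDiffAt ∞ (T% (s i)) x := contMDiffAt_localFrame_of_mem ∞ _ b i hx
  -- The Gram matrix of the local frame. The coefficients of `Y` solve the linear system with this
  -- matrix and smooth right side; the matrix is injective because a kernel vector would give a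
  -- frame combination of norm zero.
  let T : M → (Fin n → ℝ) →L[ℝ] (Fin n → ℝ) := fun y ↦ ∑ i, ∑ j,
    (inner ℝ (s i y) (s j y) : ℝ) •
      (ContinuousLinearMap.proj (R := ℝ) (φ := fun _ : Fin n ↦ ℝ) i).smulRight
      (Pi.single j 1 : Fin n → ℝ)
  have hTapp (y : M) (a : Fin n → ℝ) (j : Fin n) :
      T y a j = inner ℝ (∑ i, a i • s i y) (s j y) := by
    simp only [T, sum_inner, real_inner_smul_left]
    simp [Finset.sum_apply, Pi.single_apply, mul_comm]
  have hT : ContMDiffAt 𝓘(ℝ, E) 𝓘(ℝ, (Fin n → ℝ) →L[ℝ] (Fin n → ℝ)) ∞ T x := by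
    refine contMDiffAt_finsetSum fun i _ ↦ contMDiffAt_finsetSum fun j _ ↦ ?_
    exact (contMDiffAt_inner (hs i) (hs j)).smul contMDiffAt_const
  rw [_root_.contMDiffAt_iff_localFrameCoeff (e := t) b hx]
  have key : ContMDiffAt 𝓘(ℝ, E) 𝓘(ℝ, Fin n → ℝ) ∞ (fun y i ↦ c i y (Y y)) x := by
    refine contMDiffAt_of_clm_apply_eq hT (b := fun y i ↦ inner ℝ (Y y) (s i y)) ?_ ?_ ?_
    · rw [contMDiffAt_pi_space]
      exact fun i ↦ h _ (hs i)
    · filter_upwards [t.open_baseSet.mem_nhds hx] with y hy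
      have hli := (t.isLocalFrameOn_localFrame_baseSet 𝓘(ℝ, E) ∞ b).linearIndependent hy
      rw [injective_iff_map_eq_zero]
      intro a ha
      have h1 : (∑ i, a i • s i y) = 0 := by
        rw [← inner_self_eq_zero (𝕜 := ℝ)]
        conv_lhs => rw [inner_sum]
        refine Finset.sum_eq_zero fun j _ ↦ ?_
        rw [real_inner_smul_right, ← hTapp, ha]
        simp
      exact funext (Fintype.linearIndependent_iff.1 hli a h1)
    · filter_upwards [t.open_baseSet.mem_nhds hx] with y hy
      ext j
      rw [hTapp,
        ← Trivialization.eq_sum_localFrameCoeff_smul (e := t) (I := 𝓘(ℝ, E)) (s := Y) (b := b) hy]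
  intro i
  exact contMDiffAt_pi_space.1 key i

end Gram

/-! ### The identities as total geodesy -/

section Splitting

variable {E : Type*} [NormedAddCommGroup E] [NormedSpace ℝ E] [FiniteDimensional ℝ E]
  {M : Type*} [TopologicalSpace M] [ChartedSpace E M] [IsManifold 𝓘(ℝ, E) ∞ M]
  [RiemannianBundle (fun x : M ↦ TangentSpace 𝓘(ℝ, E) x)]

/-- The orthogonal projections onto `D` and `Dᗮ` preserve smoothness of vector fields. -/
def IsSmoothSplitting (D : SubspaceField E M) : Prop :=
  ∀ (X : VField E M) (x : M), CMDiffAt ∞ (T% X) x →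
    CMDiffAt ∞ (T% (vert D X)) x ∧ CMDiffAt ∞ (T% (hor D X)) x

/-- `∇_X Y` is a section of `D` for all sections `X`, `Y` of `D`. -/
def IsTotallyGeodesic (D : SubspaceField E M) : Prop :=
  ∀ X Y : VField E M, IsSection D X → IsSection D Y → ∀ x, nabla X Y x ∈ D x

variable {D : SubspaceField E M}

theorem vert_add_hor (X : VField E M) : vert D X + hor D X = X :=
  funext fun x ↦ (D x).starProjection_add_starProjection_orthogonal (X x)

theorem vert_mem (X : VField E M) (x : M) : vert D X x ∈ D x := (D x).starProjection_apply_mem _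

theorem hor_mem (X : VField E M) (x : M) : hor D X x ∈ (D x)ᗮ := (D x)ᗮ.starProjection_apply_mem _

theorem vert_eq_self {X : VField E M} {x : M} (h : X x ∈ D x) : vert D X x = X x :=
  Submodule.starProjection_eq_self_iff.2 h

theorem hor_eq_self {X : VField E M} {x : M} (h : X x ∈ (D x)ᗮ) : hor D X x = X x :=
  Submodule.starProjection_eq_self_iff.2 h

theorem vert_eq_zero {X : VField E M} {x : M} (h : X x ∈ (D x)ᗮ) : vert D X x = 0 := by
  have := congrFun (vert_add_hor (D := D) X) x
  rw [Pi.add_apply, hor_eq_self h] at this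
  simpa using this

theorem hor_eq_zero_iff {X : VField E M} {x : M} : hor D X x = 0 ↔ X x ∈ D x := by
  have := congrFun (vert_add_hor (D := D) X) x
  rw [Pi.add_apply] at this
  constructor
  · intro h
    rw [h, add_zero] at this
    exact this ▸ vert_mem X x
  · intro h
    rw [vert_eq_self h] at this
    simpa using this

theorem vert_orthogonal (X : VField E M) : vert (fun x ↦ (D x)ᗮ) X = hor D X := rfl

theorem hor_orthogonal (X : VField E M) : hor (fun x ↦ (D x)ᗮ) X = vert D X := by
  funext x
  simp only [hor, vert]
  congr 1
  simp [Submodule.orthogonal_orthogonal]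

theorem IsSmoothSplitting.orthogonal (h : IsSmoothSplitting D) :
    IsSmoothSplitting (fun x ↦ (D x)ᗮ) := fun X x hX ↦ by
  rw [vert_orthogonal, hor_orthogonal]
  exact (h X x hX).symm

/-- Passing from `D` to `Dᗮ` swaps `𝒱` with `ℋ` and `𝒯` with `𝒜`. Since `φ_R` and `B_R` are both `𝒱
∘ R`, and `ω_R` and `C_R` both `ℋ ∘ R`, the two identities differ only in the order of their
summands. -/
theorem horizontalIdentity_iff_verticalIdentity_orthogonal (R : EndField E M) :
    HorizontalIdentity D R ↔ VerticalIdentity (fun x ↦ (D x)ᗮ) R := by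
  refine forall₄_congr fun Z W hZ hW ↦ iff_of_eq ?_
  simp only [phi, opB, opC, omega, tensorA, tensorT, nablaHat, vert_orthogonal, hor_orthogonal]
  congr 1
  rw [add_comm]
  congr 3
  · funext x
    rw [add_comm, add_comm (hor D _) (vert D _)]
  · funext x
    rw [add_comm, add_comm (hor D (nabla (hor D _) _)) (vert D (nabla (hor D _) _))]

variable [IsContMDiffRiemannianBundle 𝓘(ℝ, E) ∞ E (fun x : M ↦ TangentSpace 𝓘(ℝ, E) x)]

theorem verticalIdentity_iff_isTotallyGeodesic (hD : IsSmoothSplitting D)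
    {J : Fin 3 → EndField E M} (hJ : IsHyperkahler J) (a : Fin 3) :
    VerticalIdentity D (J a) ↔ IsTotallyGeodesic D := by
  refine forall₄_congr fun X Y hX hY ↦ ?_
  rw [funext_iff]
  refine forall_congr' fun x ↦ ?_
  rw [← hor_eq_zero_iff (X := nabla X Y)]
  have sX : CMDiffAt ∞ (T% X) x := hX.1.contMDiffAt Filter.univ_mem
  have sY (y : M) : CMDiffAt ∞ (T% Y) y := hY.1.contMDiffAt Filter.univ_mem
  have sJY (y : M) : CMDiffAt ∞ (T% (fun y ↦ J a y (Y y))) y :=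
    ContMDiffAt.clm_bundle_apply (E₁ := fun x : M ↦ TangentSpace 𝓘(ℝ, E) x)
      (E₂ := fun x : M ↦ TangentSpace 𝓘(ℝ, E) x) (hJ.smooth a y) (sY y)
  have mX := sX.mdifferentiableAt (by simp)
  have mφ : MDiffAt (T% (phi D (J a) Y)) x := (hD _ x (sJY x)).1.mdifferentiableAt (by simp)
  have mω : MDiffAt (T% (omega D (J a) Y)) x := (hD _ x (sJY x)).2.mdifferentiableAt (by simp)
  have vX : vert D X = X := funext fun y ↦ vert_eq_self (hX.2 y)
  have vφ : vert D (phi D (J a) Y) = phi D (J a) Y := funext fun y ↦ vert_eq_self (vert_mem _ y)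
  have hφ : hor D (phi D (J a) Y) = 0 := funext fun y ↦ hor_eq_zero_iff.2 (vert_mem _ y)
  have vω : vert D (omega D (J a) Y) = 0 := funext fun y ↦ vert_eq_zero (hor_mem _ y)
  have hω : hor D (omega D (J a) Y) = omega D (J a) Y := funext fun y ↦ hor_eq_self (hor_mem _ y)
  have h0 : hor D (0 : VField E M) = 0 := funext fun y ↦ hor_eq_zero_iff.2 (Submodule.zero_mem _)
  have v0 : vert D (0 : VField E M) = 0 := funext fun y ↦ vert_eq_zero (Submodule.zero_mem _)
  have hT1 : tensorT D X (omega D (J a) Y) = vert D (nabla X (omega D (J a) Y)) := by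
    rw [tensorT, vω, hω, vX, nabla_zero, h0, zero_add]
  have hT2 : tensorT D X (phi D (J a) Y) = hor D (nabla X (phi D (J a) Y)) := by
    rw [tensorT, vφ, hφ, vX, nabla_zero, v0, add_zero]
  have hsum : nabla X (phi D (J a) Y) x + nabla X (omega D (J a) Y) x = J a x (nabla X Y x) := by
    rw [← nabla_add mX mφ mω, ← hJ.parallel a X Y hX.1 hY.1 x]
    congr 1
    exact vert_add_hor _
  -- The four summands are the vertical and horizontal parts of `∇_X(φ_R Y) + ∇_X(ω_R Y) = R ∇_X Y`;
  -- a second application of `R` gives `-∇_X Y`.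
  have key : (omega D (J a) (nablaHat D X (phi D (J a) Y) + tensorT D X (omega D (J a) Y))
      + opC D (J a) (tensorT D X (phi D (J a) Y) + hor D (nabla X (omega D (J a) Y)))) x =
      - hor D (nabla X Y) x := by
    rw [hT1, hT2, Pi.add_apply]
    simp only [omega, opC, nablaHat, hor, vert, Pi.add_apply, ← map_add]
    rw [← map_neg, ← hJ.sq a x (nabla X Y x), ← hsum]
    congr 2
    exact (D x).starProjection_add_starProjection_orthogonal _
  rw [key, Pi.zero_apply, neg_eq_zero]

/-- Total geodesy speaks of global sections only. Multiplying local fields by a bump function makes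
them global without changing their germs at `x`, on which Koszul's expression depends. -/
theorem koszul_eq_zero_of_isTotallyGeodesic [T2Space M] (hD : IsTotallyGeodesic D) {U : Set M}
    (hU : IsOpen U) {X Y Z : VField E M} (hX : SmoothFieldOn X U) (hY : SmoothFieldOn Y U)
    (hXD : ∀ y ∈ U, X y ∈ D y) (hYD : ∀ y ∈ U, Y y ∈ D y) {x : M} (hx : x ∈ U)
    (hZ : MDiffAt (T% Z) x) (hZD : Z x ∈ (D x)ᗮ) : koszul X Y Z x = 0 := by
  obtain ⟨ψ, hψU⟩ : ∃ ψ : SmoothBumpFunction 𝓘(ℝ, E) x, tsupport ψ ⊆ U := by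
    obtain ⟨ψ, -, h⟩ := (SmoothBumpFunction.nhds_basis_tsupport (I := 𝓘(ℝ, E)) x).mem_iff.1
      (hU.mem_nhds hx)
    exact ⟨ψ, h⟩
  have hext {X : VField E M} (hX : SmoothFieldOn X U) (hXD : ∀ y ∈ U, X y ∈ D y) :
      IsSection D ((ψ : M → ℝ) • X) ∧ (ψ : M → ℝ) • X =ᶠ[nhds x] X := by
    refine ⟨⟨?_, fun y ↦ ?_⟩, ?_⟩
    · exact (ContMDiffOn.smul_section_of_tsupport ψ.contMDiff.contMDiffOn hU hψU hX).contMDiffOn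
    · by_cases hy : y ∈ U
      · exact (D y).smul_mem _ (hXD y hy)
      · have : ψ y = 0 := image_eq_zero_of_notMem_tsupport fun h ↦ hy (hψU h)
        simp [this]
    · filter_upwards [ψ.eventuallyEq_one] with y hy
      change ψ y • X y = X y
      rw [hy]
      exact one_smul _ _
  obtain ⟨sX, eX⟩ := hext hX hXD
  obtain ⟨sY, eY⟩ := hext hY hYD
  have h1 := hD _ _ sX sY x
  have h2 := inner_nabla_eq_koszul ((sX.1.contMDiffAt Filter.univ_mem).mdifferentiableAt (by simp))
    ((sY.1.contMDiffAt Filter.univ_mem).mdifferentiableAt (by simp)) hZ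
  rw [(Submodule.mem_orthogonal _ _).1 hZD _ h1,
    koszul_congr eX eY (Filter.EventuallyEq.refl _ Z)] at h2
  linarith

end Splitting

/-! ### Smooth projections from a Riemannian map -/

section RiemannianMap

variable {E : Type*} [NormedAddCommGroup E] [NormedSpace ℝ E] [FiniteDimensional ℝ E]
  {M : Type*} [TopologicalSpace M] [ChartedSpace E M] [IsManifold 𝓘(ℝ, E) ∞ M]
  [RiemannianBundle (fun x : M ↦ TangentSpace 𝓘(ℝ, E) x)]
  [IsContMDiffRiemannianBundle 𝓘(ℝ, E) ∞ E (fun x : M ↦ TangentSpace 𝓘(ℝ, E) x)]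
  {E' : Type*} [NormedAddCommGroup E'] [NormedSpace ℝ E'] [FiniteDimensional ℝ E']
  {N : Type*} [TopologicalSpace N] [ChartedSpace E' N] [IsManifold 𝓘(ℝ, E') ∞ N]
  [RiemannianBundle (fun y : N ↦ TangentSpace 𝓘(ℝ, E') y)]
  [IsContMDiffRiemannianBundle 𝓘(ℝ, E') ∞ E' (fun y : N ↦ TangentSpace 𝓘(ℝ, E') y)]

/-- For every smooth `Z`, `g_M(ℋX, Z) = g_N(F_* X, F_* Z)`, whose right side is smooth; hence `ℋX`
is smooth, and so is `𝒱X = X - ℋX`. -/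
theorem IsRiemannianMap.isSmoothSplitting {F : M → N} (hF : IsRiemannianMap E E' F) :
    IsSmoothSplitting (kerField E E' F) := by
  intro X x hX
  set D := kerField E E' F with hD
  have hdF (Y : VField E M) (y : M) : mfderiv 𝓘(ℝ, E) 𝓘(ℝ, E') F y (Y y) =
      mfderiv 𝓘(ℝ, E) 𝓘(ℝ, E') F y (hor D Y y) := by
    have h1 := congrFun (vert_add_hor (D := D) Y) y
    have h2 : mfderiv 𝓘(ℝ, E) 𝓘(ℝ, E') F y (vert D Y y) = 0 := vert_mem (D := D) Y y
    conv_lhs => rw [← h1, Pi.add_apply, map_add, h2, zero_add]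
  have hor_smooth : CMDiffAt ∞ (T% (hor D X)) x := by
    refine contMDiffAt_of_inner fun Z hZ ↦ ?_
    have h1 := contMDiffAt_mfderiv_apply (hF.1 x) hX
    have h2 := contMDiffAt_mfderiv_apply (hF.1 x) hZ
    have h3 : ContMDiffAt 𝓘(ℝ, E) 𝓘(ℝ) ∞ (fun y ↦ (inner ℝ (mfderiv 𝓘(ℝ, E) 𝓘(ℝ, E') F y (X y))
        (mfderiv 𝓘(ℝ, E) 𝓘(ℝ, E') F y (Z y)) : ℝ)) x :=
      ContMDiffAt.inner_bundle (E := fun y : N ↦ TangentSpace 𝓘(ℝ, E') y) (b := F) h1 h2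
    refine h3.congr_of_eventuallyEq (Filter.Eventually.of_forall fun y ↦ ?_)
    beta_reduce
    rw [hdF X, hdF Z, hF.2 y _ (hor_mem X y) _ (hor_mem Z y)]
    have h3 := congrFun (vert_add_hor (D := D) Z) y
    conv_lhs => rw [← h3, Pi.add_apply, inner_add_right, real_inner_comm,
      (Submodule.mem_orthogonal _ _).1 (hor_mem X y) _ (vert_mem Z y), zero_add]
  refine ⟨?_, hor_smooth⟩
  have h1 : vert D X = X - hor D X := eq_sub_of_add_eq (vert_add_hor X)
  rw [h1]
  exact ContMDiffAt.sub_section hX hor_smooth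

end RiemannianMap

/-! ### Koszul's formula in a product metric -/

section Product

variable {E : Type*} [NormedAddCommGroup E] [NormedSpace ℝ E] [FiniteDimensional ℝ E]
  {M : Type*} [TopologicalSpace M] [ChartedSpace E M] [IsManifold 𝓘(ℝ, E) ∞ M]
  {W₁ : Type*} [NormedAddCommGroup W₁] [NormedSpace ℝ W₁]
  {W₂ : Type*} [NormedAddCommGroup W₂] [NormedSpace ℝ W₂]

theorem mvfderiv_fst {f : M → W₁ × W₂} {x : M} (hf : MDifferentiableAt 𝓘(ℝ, E) 𝓘(ℝ, W₁ × W₂) f x)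
    (u : TangentSpace 𝓘(ℝ, E) x) :
    mvfderiv 𝓘(ℝ, E) (fun y ↦ (f y).1) x u = (mvfderiv 𝓘(ℝ, E) f x u).1 := by
  rw [mvfderiv_comp_fderiv (g := Prod.fst) differentiableAt_fst hf, fderiv_fst]
  rfl

theorem mvfderiv_snd {f : M → W₁ × W₂} {x : M} (hf : MDifferentiableAt 𝓘(ℝ, E) 𝓘(ℝ, W₁ × W₂) f x)
    (u : TangentSpace 𝓘(ℝ, E) x) :
    mvfderiv 𝓘(ℝ, E) (fun y ↦ (f y).2) x u = (mvfderiv 𝓘(ℝ, E) f x u).2 := by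
  rw [mvfderiv_comp_fderiv (g := Prod.snd) differentiableAt_snd hf, fderiv_snd]
  rfl

theorem mvfderiv_eq_zero {f : M → W₁} {c : W₁} {x : M} (hf : f =ᶠ[nhds x] fun _ ↦ c)
    (u : TangentSpace 𝓘(ℝ, E) x) : mvfderiv 𝓘(ℝ, E) f x u = 0 := by
  rw [mvfderiv_congr hf, mvfderiv_const]
  rfl

theorem mvfderiv_bilinear_apply {h : W₁ → W₁ →L[ℝ] W₁ →L[ℝ] ℝ} {f ξ η : M → W₁} {x : M}
    (hh : DifferentiableAt ℝ h (f x)) (hf : MDiffAt f x) (hξ : MDiffAt ξ x) (hη : MDiffAt η x)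
    (u : TangentSpace 𝓘(ℝ, E) x) :
    mvfderiv 𝓘(ℝ, E) (fun y ↦ h (f y) (ξ y) (η y)) x u =
      fderiv ℝ h (f x) (mvfderiv 𝓘(ℝ, E) f x u) (ξ x) (η x) +
        h (f x) (mvfderiv 𝓘(ℝ, E) ξ x u) (η x) + h (f x) (ξ x) (mvfderiv 𝓘(ℝ, E) η x u) := by
  have hG2 : MDifferentiableAt 𝓘(ℝ, E) 𝓘(ℝ, W₁ × W₁) (fun y ↦ (ξ y, η y)) x := hξ.prodMk_space hη
  have hG : MDifferentiableAt 𝓘(ℝ, E) 𝓘(ℝ, W₁ × W₁ × W₁) (fun y ↦ (f y, ξ y, η y)) x :=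
    hf.prodMk_space hG2
  have hd : HasFDerivAt (fun p : W₁ × W₁ × W₁ ↦ h p.1 p.2.1 p.2.2) _ (f x, ξ x, η x) :=
    HasFDerivAt.clm_apply (c := fun p : W₁ × W₁ × W₁ ↦ h p.1 p.2.1)
      (HasFDerivAt.clm_apply (c := fun p : W₁ × W₁ × W₁ ↦ h p.1)
        (HasFDerivAt.comp (f := Prod.fst) (f x, ξ x, η x) hh.hasFDerivAt hasFDerivAt_fst)
        (hasFDerivAt_snd.fst)) hasFDerivAt_snd.snd
  refine (mvfderiv_comp_fderiv (f := fun y ↦ (f y, ξ y, η y)) (x := x)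
    (g := fun p : W₁ × W₁ × W₁ ↦ h p.1 p.2.1 p.2.2) hd.differentiableAt hG u).trans ?_
  rw [hd.fderiv]
  have e1 := mvfderiv_fst hG u
  have e2 := mvfderiv_snd hG u
  have e3 := mvfderiv_fst hG2 u
  have e4 := mvfderiv_snd hG2 u
  rw [e2] at e3 e4
  simp only at e1 e2 e3 e4
  simp [e1, e3, e4]
  ring

variable [RiemannianBundle (fun x : M ↦ TangentSpace 𝓘(ℝ, E) x)]
    [IsContMDiffRiemannianBundle 𝓘(ℝ, E) ∞ E (fun x : M ↦ TangentSpace 𝓘(ℝ, E) x)]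

set_option synthInstance.maxHeartbeats 200000 in
-- `g(X, Z)` and `g(Y, Z)` vanish, as does `df₁ Z`, and `[X, Y]` stays in the kernel of `df₂`. The
-- remaining terms cancel: `Z h(df₁ X, df₁ Y)` has no contribution from the derivative of `h`, and
-- `df₁ [X, Z] = -Z(df₁ X)`, likewise for `Y`.
theorem koszul_eq_zero_of_product {f₁ : M → W₁} {f₂ : M → W₂} {h : W₁ → W₁ →L[ℝ] W₁ →L[ℝ] ℝ}
    {x : M} (hf₁ : ContMDiffAt 𝓘(ℝ, E) 𝓘(ℝ, W₁) ∞ f₁ x) (hf₂ : ContMDiffAt 𝓘(ℝ, E) 𝓘(ℝ, W₂) ∞ f₂ x)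
    (hh : DifferentiableAt ℝ h (f₁ x)) (hsymm : ∀ ξ η, h (f₁ x) ξ η = h (f₁ x) η ξ)
    (hg : ∀ᶠ y in nhds x, ∀ u v : TangentSpace 𝓘(ℝ, E) y, mvfderiv 𝓘(ℝ, E) f₂ y v = 0 →
      (inner ℝ u v : ℝ) = h (f₁ y) (mvfderiv 𝓘(ℝ, E) f₁ y u) (mvfderiv 𝓘(ℝ, E) f₁ y v))
    {X Y Z : VField E M} (hX : CMDiffAt ∞ (T% X) x) (hY : CMDiffAt ∞ (T% Y) x)
    (hZ : CMDiffAt ∞ (T% Z) x) (hX₂ : ∀ᶠ y in nhds x, mvfderiv 𝓘(ℝ, E) f₂ y (X y) = 0)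
    (hY₂ : ∀ᶠ y in nhds x, mvfderiv 𝓘(ℝ, E) f₂ y (Y y) = 0)
    (hZ₁ : ∀ᶠ y in nhds x, mvfderiv 𝓘(ℝ, E) f₁ y (Z y) = 0) : koszul X Y Z x = 0 := by
  have dX := hX.mdifferentiableAt (by simp)
  have dY := hY.mdifferentiableAt (by simp)
  have dZ := hZ.mdifferentiableAt (by simp)
  have orth {V : VField E M} (hV : ∀ᶠ y in nhds x, mvfderiv 𝓘(ℝ, E) f₂ y (V y) = 0) :
      (fun y ↦ (inner ℝ (V y) (Z y) : ℝ)) =ᶠ[nhds x] fun _ ↦ 0 := by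
    filter_upwards [hg, hV, hZ₁] with y h1 h2 h3
    rw [real_inner_comm, h1 _ _ h2, h3]
    simp
  have hXY : (fun y ↦ (inner ℝ (X y) (Y y) : ℝ)) =ᶠ[nhds x] fun y ↦
      h (f₁ y) (mvfderiv 𝓘(ℝ, E) f₁ y (X y)) (mvfderiv 𝓘(ℝ, E) f₁ y (Y y)) := by
    filter_upwards [hg, hY₂] with y h1 h2
    exact h1 _ _ h2
  have b12 : mvfderiv 𝓘(ℝ, E) f₂ x (VectorField.mlieBracket 𝓘(ℝ, E) X Y x) = 0 := by
    rw [mvfderiv_mlieBracket hf₂ dX dY, mvfderiv_eq_zero hY₂, mvfderiv_eq_zero hX₂, sub_zero]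
  have b13 := mvfderiv_mlieBracket hf₁ dX dZ
  have b23 := mvfderiv_mlieBracket hf₁ dY dZ
  rw [mvfderiv_eq_zero hZ₁, zero_sub] at b13 b23
  have t4 : (inner ℝ (VectorField.mlieBracket 𝓘(ℝ, E) X Y x) (Z x) : ℝ) = 0 := by
    rw [real_inner_comm, hg.self_of_nhds _ _ b12, hZ₁.self_of_nhds]
    simp
  rw [koszul, mvfderiv_congr (orth hY₂), mvfderiv_congr (orth hX₂), mvfderiv_congr hXY, t4,
    hg.self_of_nhds _ _ hY₂.self_of_nhds, hg.self_of_nhds _ _ hX₂.self_of_nhds, b13, b23,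
    mvfderiv_bilinear_apply hh (hf₁.mdifferentiableAt (by simp))
      ((contMDiffAt_mvfderiv_apply hf₁ hX).mdifferentiableAt (by simp))
      ((contMDiffAt_mvfderiv_apply hf₁ hY).mdifferentiableAt (by simp)),
    hZ₁.self_of_nhds, mvfderiv_const, hsymm _ (mvfderiv 𝓘(ℝ, E) f₁ x (X x))]
  simp

theorem nabla_mem_of_product {D : SubspaceField E M} (hD : IsSmoothSplitting D)
    {f₁ : M → W₁} {f₂ : M → W₂} {h : W₁ → W₁ →L[ℝ] W₁ →L[ℝ] ℝ}
    {x : M} (hf₁ : ContMDiffAt 𝓘(ℝ, E) 𝓘(ℝ, W₁) ∞ f₁ x) (hf₂ : ContMDiffAt 𝓘(ℝ, E) 𝓘(ℝ, W₂) ∞ f₂ x)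
    (hh : DifferentiableAt ℝ h (f₁ x)) (hsymm : ∀ ξ η, h (f₁ x) ξ η = h (f₁ x) η ξ)
    (hg : ∀ᶠ y in nhds x, ∀ u v : TangentSpace 𝓘(ℝ, E) y, mvfderiv 𝓘(ℝ, E) f₂ y v = 0 →
      (inner ℝ u v : ℝ) = h (f₁ y) (mvfderiv 𝓘(ℝ, E) f₁ y u) (mvfderiv 𝓘(ℝ, E) f₁ y v))
    (h₂ : ∀ᶠ y in nhds x, ∀ u ∈ D y, mvfderiv 𝓘(ℝ, E) f₂ y u = 0)
    (h₁ : ∀ᶠ y in nhds x, ∀ u ∈ (D y)ᗮ, mvfderiv 𝓘(ℝ, E) f₁ y u = 0)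
    {X Y : VField E M} (hX : IsSection D X) (hY : IsSection D Y) : nabla X Y x ∈ D x := by
  have sX : CMDiffAt ∞ (T% X) x := hX.1.contMDiffAt Filter.univ_mem
  have sY : CMDiffAt ∞ (T% Y) x := hY.1.contMDiffAt Filter.univ_mem
  rw [← (D x).orthogonal_orthogonal, Submodule.mem_orthogonal]
  intro w hw
  -- Projecting an arbitrary extension of `w` gives a field that is horizontal on a whole
  -- neighbourhood, as the Koszul computation requires.
  have sZ := (hD _ x (FiberBundle.contMDiffAt_extend 𝓘(ℝ, E) E w)).2
  have hZw : hor D (FiberBundle.extend E w) x = w := by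
    rw [hor_eq_self] <;> simp [hw]
  rw [real_inner_comm]
  nth_rw 1 [← hZw]
  rw [inner_nabla_eq_koszul (sX.mdifferentiableAt (by simp)) (sY.mdifferentiableAt (by simp))
    (sZ.mdifferentiableAt (by simp)), koszul_eq_zero_of_product hf₁ hf₂ hh hsymm hg sX sY sZ
      (h₂.mono fun y h ↦ h _ (hX.2 y)) (h₂.mono fun y h ↦ h _ (hY.2 y))
      (h₁.mono fun y h ↦ h _ (hor_mem _ y)), mul_zero]

end Product

/-! ### A local product has totally geodesic factors -/

section LocalProduct

variable {E : Type*} [NormedAddCommGroup E] [NormedSpace ℝ E] [FiniteDimensional ℝ E]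
  {M : Type*} [TopologicalSpace M] [ChartedSpace E M] [IsManifold 𝓘(ℝ, E) ∞ M]
  [RiemannianBundle (fun x : M ↦ TangentSpace 𝓘(ℝ, E) x)]
  [IsContMDiffRiemannianBundle 𝓘(ℝ, E) ∞ E (fun x : M ↦ TangentSpace 𝓘(ℝ, E) x)]
  {D : SubspaceField E M}

theorem IsMetricOn.differentiableAt {n : ℕ} {V : Set (EuclideanSpace ℝ (Fin n))}
    {h : EuclideanSpace ℝ (Fin n) →
      EuclideanSpace ℝ (Fin n) →L[ℝ] EuclideanSpace ℝ (Fin n) →L[ℝ] ℝ}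
    (hh : IsMetricOn V h) (hV : IsOpen V) {y : EuclideanSpace ℝ (Fin n)} (hy : y ∈ V) :
    DifferentiableAt ℝ h y :=
  (hh.smooth.contDiffAt (hV.mem_nhds hy)).differentiableAt (by simp)

theorem IsLocalRiemannianProduct.isTotallyGeodesic (hD : IsSmoothSplitting D)
    (h : IsLocalRiemannianProduct D) :
    IsTotallyGeodesic D ∧ IsTotallyGeodesic (fun x ↦ (D x)ᗮ) := by
  have key (p : M) : ∀ X Y : VField E M, (IsSection D X → IsSection D Y → nabla X Y p ∈ D p) ∧
      (IsSection (fun x ↦ (D x)ᗮ) X → IsSection (fun x ↦ (D x)ᗮ) Y → nabla X Y p ∈ (D p)ᗮ) := by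
    intro X Y
    obtain ⟨a, b, e, V₁, V₂, h₁, h₂, hp, ht, oV₁, -, oV₂, -, m₁, m₂, se, -, H⟩ := h p
    have hs : ∀ᶠ y in nhds p, y ∈ e.source := e.open_source.mem_nhds hp
    have hmem : e p ∈ V₁ ×ˢ V₂ := ht ▸ e.map_source hp
    have sep := se.contMDiffAt hs
    have s₁ : ContMDiffAt 𝓘(ℝ, E) 𝓘(ℝ, EuclideanSpace ℝ (Fin a)) ∞ (fun z ↦ (e z).1) p :=
      contDiff_fst.contMDiff.contMDiffAt.comp p sep
    have s₂ : ContMDiffAt 𝓘(ℝ, E) 𝓘(ℝ, EuclideanSpace ℝ (Fin b)) ∞ (fun z ↦ (e z).2) p :=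
      contDiff_snd.contMDiff.contMDiffAt.comp p sep
    have d₂ : ∀ᶠ y in nhds p, ∀ u ∈ D y, mvfderiv 𝓘(ℝ, E) (fun z ↦ (e z).2) y u = 0 :=
      hs.mono fun y hy u hu ↦ ((H y hy).2.1 u).1 hu
    have d₁ : ∀ᶠ y in nhds p, ∀ u ∈ (D y)ᗮ, mvfderiv 𝓘(ℝ, E) (fun z ↦ (e z).1) y u = 0 :=
      hs.mono fun y hy u hu ↦ ((H y hy).2.2 u).1 hu
    refine ⟨nabla_mem_of_product hD s₁ s₂ (m₁.differentiableAt oV₁ hmem.1) (m₁.symm _ hmem.1)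
      ?_ d₂ d₁,
      nabla_mem_of_product hD.orthogonal s₂ s₁ (m₂.differentiableAt oV₂ hmem.2) (m₂.symm _ hmem.2)
        ?_ d₁ (d₂.mono fun y h u hu ↦ h u (by rwa [Submodule.orthogonal_orthogonal] at hu))⟩
    · filter_upwards [hs] with y hy u v hv
      rw [(H y hy).1, hv, map_zero, add_zero]
    · filter_upwards [hs] with y hy u v hv
      rw [(H y hy).1, hv, map_zero, zero_add]
  exact ⟨fun X Y hX hY p ↦ (key p X Y).1 hX hY, fun X Y hX hY p ↦ (key p X Y).2 hX hY⟩

end LocalProduct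

/-! ### Charts with values in a normed space -/

section SmoothChart

variable {E : Type*} [NormedAddCommGroup E] [NormedSpace ℝ E] [FiniteDimensional ℝ E]
  {M : Type*} [TopologicalSpace M] [ChartedSpace E M] [IsManifold 𝓘(ℝ, E) ∞ M]
  {W : Type*} [NormedAddCommGroup W] [NormedSpace ℝ W]
  {W' : Type*} [NormedAddCommGroup W'] [NormedSpace ℝ W']

variable (E) in
/-- A diffeomorphism from an open subset of `M` onto an open subset of a normed space. -/
structure IsSmoothChart (e : OpenPartialHomeomorph M W) : Prop where
  smooth : ContMDiffOn 𝓘(ℝ, E) 𝓘(ℝ, W) ∞ e e.source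
  smooth_symm : ContMDiffOn 𝓘(ℝ, W) 𝓘(ℝ, E) ∞ e.symm e.target

/-- The vector field with constant components `c` in the chart `e`. -/
def coordField (e : OpenPartialHomeomorph M W) (c : W) : VField E M :=
  fun x ↦ (mvfderiv 𝓘(ℝ, E) e x).inverse c

namespace IsSmoothChart

variable {e : OpenPartialHomeomorph M W}

theorem contMDiffAt (he : IsSmoothChart E e) {x : M}
    (hx : x ∈ e.source) : ContMDiffAt 𝓘(ℝ, E) 𝓘(ℝ, W) ∞ e x :=
  he.smooth.contMDiffAt (e.open_source.mem_nhds hx)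

theorem mdifferentiableAt (he : IsSmoothChart E e) {x : M}
    (hx : x ∈ e.source) : MDifferentiableAt 𝓘(ℝ, E) 𝓘(ℝ, W) e x :=
  (he.contMDiffAt hx).mdifferentiableAt (by simp)

theorem contMDiffAt_symm (he : IsSmoothChart E e) {z : W} (hz : z ∈ e.target) :
    ContMDiffAt 𝓘(ℝ, W) 𝓘(ℝ, E) ∞ e.symm z :=
  he.smooth_symm.contMDiffAt (e.open_target.mem_nhds hz)

theorem isInvertible (he : IsSmoothChart E e) {x : M}
    (hx : x ∈ e.source) : (mvfderiv 𝓘(ℝ, E) e x).IsInvertible := by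
  have h : OpenPartialHomeomorph.MDifferentiable 𝓘(ℝ, E) 𝓘(ℝ, W) e :=
    ⟨he.smooth.mdifferentiableOn (by simp), he.smooth_symm.mdifferentiableOn (by simp)⟩
  exact ⟨h.mfderiv hx, rfl⟩

theorem mvfderiv_coordField (he : IsSmoothChart E e) {x : M}
    (hx : x ∈ e.source) (c : W) :
    mvfderiv 𝓘(ℝ, E) e x (coordField e c x) = c :=
  (he.isInvertible hx).self_apply_inverse c

theorem mvfderiv_injective (he : IsSmoothChart E e) {x : M}
    (hx : x ∈ e.source) :
    Function.Injective (mvfderiv 𝓘(ℝ, E) e x) := (he.isInvertible hx).injective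

theorem contMDiffAt_inverse_apply (he : IsSmoothChart E e) {x : M}
    (hx : x ∈ e.source) {V : W → W}
    (hV : ContDiffAt ℝ ∞ V (e x)) :
    CMDiffAt ∞ (T% (fun y ↦ (mvfderiv 𝓘(ℝ, E) e y).inverse (V (e y)) : VField E M)) x :=
  ContMDiffAt.mpullback_vectorField_preimage (I' := 𝓘(ℝ, W)) (n := ∞)
    (V := V) (contMDiffAt_vectorSpace_iff_contDiffAt.2 hV)
    (he.contMDiffAt hx) (he.isInvertible hx) (by simp)

theorem contMDiffAt_coordField (he : IsSmoothChart E e) {x : M}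
    (hx : x ∈ e.source) (c : W) :
    CMDiffAt ∞ (T% (coordField e c : VField E M)) x :=
  he.contMDiffAt_inverse_apply hx contDiffAt_const

theorem mlieBracket_coordField (he : IsSmoothChart E e) {x : M}
    (hx : x ∈ e.source) (c c' : W) :
    VectorField.mlieBracket 𝓘(ℝ, E) (coordField e c) (coordField e c') x = 0 := by
  have hc (c : W) : (fun y ↦ mvfderiv 𝓘(ℝ, E) e y (coordField e c y)) =ᶠ[nhds x] fun _ ↦ c := by
    filter_upwards [e.open_source.mem_nhds hx] with y hy using he.mvfderiv_coordField hy c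
  refine he.mvfderiv_injective hx ?_
  rw [mvfderiv_mlieBracket (he.contMDiffAt hx)
    ((he.contMDiffAt_coordField hx c).mdifferentiableAt (by simp))
    ((he.contMDiffAt_coordField hx c').mdifferentiableAt (by simp)), mvfderiv_eq_zero (hc c),
    mvfderiv_eq_zero (hc c'), sub_zero, map_zero]

theorem restrict (he : IsSmoothChart E e) {s : Set W} (hs : IsOpen s) :
    IsSmoothChart E (e.symm.restrOpen s hs).symm where
  smooth := he.smooth.mono fun x hx ↦ by
    simpa using And.left hx
  smooth_symm := he.smooth_symm.mono fun x hx ↦ by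
    simpa using And.left hx

theorem restrOpen (he : IsSmoothChart E e) {s : Set M} (hs : IsOpen s) :
    IsSmoothChart E (e.restrOpen s hs) where
  smooth := he.smooth.mono fun x hx ↦ by
    simpa using And.left hx
  smooth_symm := he.smooth_symm.mono fun x hx ↦ by
    simpa using And.left hx

theorem trans (he : IsSmoothChart E e) {Φ : OpenPartialHomeomorph W W'}
    (hΦ : ContDiffOn ℝ ∞ Φ Φ.source)
    (hΦ' : ContDiffOn ℝ ∞ Φ.symm Φ.target) : IsSmoothChart E (e ≫ₕ Φ) where
  smooth := hΦ.contMDiffOn.comp (he.smooth.mono fun _ hx ↦ And.left hx) fun _ hx ↦ And.right hx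
  smooth_symm := he.smooth_symm.comp (hΦ'.contMDiffOn.mono fun _ hx ↦ And.left hx)
    fun _ hx ↦ And.right hx

end IsSmoothChart

variable (E) in
theorem isSmoothChart_chartAt (p : M) : IsSmoothChart E (chartAt E p) where
  smooth := contMDiffOn_chart
  smooth_symm := contMDiffOn_chart_symm

theorem exists_smoothChart_of_isInvertible {f : M → W} {U : Set M} (hU : IsOpen U)
    (hf : ContMDiffOn 𝓘(ℝ, E) 𝓘(ℝ, W) ∞ f U) {p : M} (hp : p ∈ U)
    (hi : (mvfderiv 𝓘(ℝ, E) f p).IsInvertible) :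
    ∃ e : OpenPartialHomeomorph M W, IsSmoothChart E e ∧ p ∈ e.source ∧ e.source ⊆ U ∧
      Set.EqOn e f e.source := by
  set φ := chartAt E p
  have hφ : IsSmoothChart E φ := isSmoothChart_chartAt E p
  have hpφ : p ∈ φ.source := mem_chart_source E p
  have hO : IsOpen (φ.target ∩ φ.symm ⁻¹' U) := φ.isOpen_inter_preimage_symm hU
  have hg : ContDiffOn ℝ ∞ (fun z ↦ f (φ.symm z)) (φ.target ∩ φ.symm ⁻¹' U) := by
    rw [← contMDiffOn_iff_contDiffOn]
    exact hf.comp (hφ.smooth_symm.mono Set.inter_subset_left) fun z hz ↦ hz.2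
  have hpO : φ p ∈ φ.target ∩ φ.symm ⁻¹' U := ⟨φ.map_source hpφ, by simpa [φ.left_inv hpφ]⟩
  have hgp : (fderiv ℝ (fun z ↦ f (φ.symm z)) (φ p)).IsInvertible := by
    have h1 : ∀ u : E, mvfderiv 𝓘(ℝ, E) f p u = fderiv ℝ (fun z ↦ f (φ.symm z)) (φ p)
        (mvfderiv 𝓘(ℝ, E) φ p u) := fun u ↦
      mvfderiv_eq_fderiv_writtenInChart ((hf.contMDiffAt (hU.mem_nhds hp)).mdifferentiableAt
        (by simp)) (mem_extChartAt_source p) u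
    obtain ⟨e₁, he₁⟩ := hi
    obtain ⟨e₂, he₂⟩ := hφ.isInvertible hpφ
    refine ⟨e₂.symm.trans e₁, ?_⟩
    ext v
    have h2 := h1 (e₂.symm v)
    rw [← he₁, ← he₂] at h2
    refine h2.trans ?_
    congr 1
    exact e₂.apply_symm_apply v
  obtain ⟨Φ, hΦ, hpΦ, hΦs, hΦt, -⟩ := exists_openPartialHomeomorph_of_contDiffOn hO hg hpO hgp
  refine ⟨φ ≫ₕ Φ, hφ.trans ?_ hΦt, ⟨hpφ, hpΦ⟩, fun x hx ↦ ?_, fun x hx ↦ ?_⟩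
  · rw [hΦ]
    exact hg.mono hΦs
  · simpa [φ.left_inv hx.1] using (hΦs hx.2).2
  · simp [hΦ, φ.left_inv hx.1]

end SmoothChart

/-! ### Distributions as graphs -/

section GraphChart

variable {E : Type*} [NormedAddCommGroup E] [NormedSpace ℝ E] [FiniteDimensional ℝ E]
  {M : Type*} [TopologicalSpace M] [ChartedSpace E M] [IsManifold 𝓘(ℝ, E) ∞ M]

theorem contMDiffAt_of_forall_apply {V W : Type*} [NormedAddCommGroup V] [NormedSpace ℝ V]
    [FiniteDimensional ℝ V] [NormedAddCommGroup W] [NormedSpace ℝ W] {T : M → V →L[ℝ] W} {x : M}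
    (h : ∀ c, ContMDiffAt 𝓘(ℝ, E) 𝓘(ℝ, W) ∞ (fun y ↦ T y c) x) :
    ContMDiffAt 𝓘(ℝ, E) 𝓘(ℝ, V →L[ℝ] W) ∞ T x := by
  have hT : T = fun y ↦ ∑ i, ContinuousLinearMap.smulRightL ℝ V W
      (LinearMap.toContinuousLinearMap ((Module.finBasis ℝ V).coord i))
        (T y (Module.finBasis ℝ V i)) := by
    funext y
    ext v
    conv_lhs => rw [← (Module.finBasis ℝ V).sum_repr v]
    rw [map_sum]
    simp
  rw [hT]
  refine contMDiffAt_finsetSum fun i _ ↦ ?_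
  exact (ContinuousLinearMap.contMDiff _).contMDiffAt.comp x (h _)

theorem eventually_isInvertible {V : Type*} [NormedAddCommGroup V] [NormedSpace ℝ V]
    [CompleteSpace V] {T : M → V →L[ℝ] V} {x : M} (hT : ContinuousAt T x)
    (hx : T x = ContinuousLinearMap.id ℝ V) : ∀ᶠ y in nhds x, (T y).IsInvertible :=
  hT.eventually_mem (ContinuousLinearEquiv.isOpen.mem_nhds
    ⟨ContinuousLinearEquiv.refl ℝ V, hx.symm⟩)

variable [RiemannianBundle (fun x : M ↦ TangentSpace 𝓘(ℝ, E) x)]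
  {D : SubspaceField E M}

variable (D) in
/-- A chart centred at `p` whose differential at `p` carries `Dᗮ` and `D` to the two factors. -/
theorem exists_adapted_chart (p : M) :
    ∃ e : OpenPartialHomeomorph M (EuclideanSpace ℝ (Fin (Module.finrank ℝ (D p)ᗮ)) ×
        EuclideanSpace ℝ (Fin (Module.finrank ℝ (D p)))), IsSmoothChart E e ∧ p ∈ e.source ∧
      e p = 0 ∧ (∀ u ∈ D p, (mvfderiv 𝓘(ℝ, E) e p u).1 = 0) ∧
      ∀ u ∈ (D p)ᗮ, (mvfderiv 𝓘(ℝ, E) e p u).2 = 0 := by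
  let α := (stdOrthonormalBasis ℝ (D p)ᗮ).repr
  let β := (stdOrthonormalBasis ℝ (D p)).repr
  let l : TangentSpace 𝓘(ℝ, E) p →ₗ[ℝ] EuclideanSpace ℝ (Fin (Module.finrank ℝ (D p)ᗮ)) ×
        EuclideanSpace ℝ (Fin (Module.finrank ℝ (D p))) :=
    (α.toLinearEquiv.toLinearMap ∘ₗ (D p)ᗮ.orthogonalProjectionOnto.toLinearMap).prod
      (β.toLinearEquiv.toLinearMap ∘ₗ (D p).orthogonalProjectionOnto.toLinearMap)
  have l1 (u) : (l u).1 = α ((D p)ᗮ.orthogonalProjectionOnto u) := rfl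
  have l2 (u) : (l u).2 = β ((D p).orthogonalProjectionOnto u) := rfl
  have linj : Function.Injective l := by
    rw [injective_iff_map_eq_zero]
    intro u hu
    have h1 := congrArg Prod.fst hu
    have h2 := congrArg Prod.snd hu
    rw [l1] at h1
    rw [l2] at h2
    have h3 := (D p).starProjection_add_starProjection_orthogonal u
    rw [← h3, Submodule.starProjection_apply, Submodule.starProjection_apply,
      α.map_eq_zero_iff.1 h1, β.map_eq_zero_iff.1 h2]
    simp
  let L : E ≃L[ℝ] EuclideanSpace ℝ (Fin (Module.finrank ℝ (D p)ᗮ)) ×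
        EuclideanSpace ℝ (Fin (Module.finrank ℝ (D p))) :=
    (LinearEquiv.ofInjectiveOfFinrankEq l linj (by
      rw [Module.finrank_prod, finrank_euclideanSpace_fin, finrank_euclideanSpace_fin, add_comm,
        Submodule.finrank_add_finrank_orthogonal])).toContinuousLinearEquiv
  have hL (u : E) : L u = l u := rfl
  let φ := chartAt E p
  have hp : p ∈ φ.source := mem_chart_source E p
  have hφ : IsSmoothChart E φ := isSmoothChart_chartAt E p
  let Φ : OpenPartialHomeomorph E (EuclideanSpace ℝ (Fin (Module.finrank ℝ (D p)ᗮ)) ×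
        EuclideanSpace ℝ (Fin (Module.finrank ℝ (D p)))) :=
    ((Homeomorph.addRight (-φ p)).trans L.toHomeomorph).toOpenPartialHomeomorph
  have hΦ (z : E) : Φ z = L (z + -φ p) := rfl
  have hΦc : ContDiff ℝ ∞ Φ := L.contDiff.comp (contDiff_id.add contDiff_const)
  have hd (u : TangentSpace 𝓘(ℝ, E) p) : mvfderiv 𝓘(ℝ, E) (φ ≫ₕ Φ) p u = l u := by
    refine (mvfderiv_comp_fderiv (f := φ) (g := Φ) (x := p)
      (hΦc.differentiable (by simp)).differentiableAt (hφ.mdifferentiableAt hp) u).trans ?_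
    have h1 : HasFDerivAt Φ (L : E →L[ℝ] _) (φ p) :=
      L.hasFDerivAt.comp (φ p) ((hasFDerivAt_id (φ p)).add_const (-φ p))
    have h2 := congrArg (fun T : E →L[ℝ] E ↦ T u) (mfderiv_extChartAt_self (I := 𝓘(ℝ, E)) (x := p))
    rw [h1.fderiv]
    exact congrArg L h2
  refine ⟨φ ≫ₕ Φ, hφ.trans hΦc.contDiffOn ?_, ⟨hp, Set.mem_univ _⟩, ?_, fun u hu ↦ ?_,
    fun u hu ↦ ?_⟩
  · exact (L.symm.contDiff.add contDiff_const).contDiffOn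
  · change Φ (φ p) = 0
    rw [hΦ, add_neg_cancel, map_zero]
  · rw [hd, l1, Submodule.orthogonalProjectionOnto_orthogonal_apply_eq_zero hu, map_zero]
  · rw [hd, l2, Submodule.orthogonalProjectionOnto_eq_zero_iff.2 hu, map_zero]

variable [IsContMDiffRiemannianBundle 𝓘(ℝ, E) ∞ E (fun x : M ↦ TangentSpace 𝓘(ℝ, E) x)]

/-- At `p` the subspace `D` is `0 × W₂` in the chart. Nearby, a vector is in `D` when the
`W₁`-component of its horizontal part vanishes, and this equation can be solved for the
`W₁`-component of the vector. Only smoothness of the projections is used. -/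
theorem eventually_graph {W₁ W₂ : Type*} [NormedAddCommGroup W₁] [NormedSpace ℝ W₁]
    [FiniteDimensional ℝ W₁] [NormedAddCommGroup W₂] [NormedSpace ℝ W₂] [FiniteDimensional ℝ W₂]
    (hD : IsSmoothSplitting D) {e : OpenPartialHomeomorph M (W₁ × W₂)} (he : IsSmoothChart E e)
    {p : M} (hp : p ∈ e.source) (hep₁ : ∀ u ∈ D p, (mvfderiv 𝓘(ℝ, E) e p u).1 = 0)
    (hep₂ : ∀ u ∈ (D p)ᗮ, (mvfderiv 𝓘(ℝ, E) e p u).2 = 0) :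
    ∃ (U : Set M) (A : W₁ × W₂ → W₂ →L[ℝ] W₁), IsOpen U ∧ p ∈ U ∧
      (∀ x ∈ e.source ∩ U, ContDiffAt ℝ ∞ A (e x)) ∧
      ∀ x ∈ e.source ∩ U, ∀ u : TangentSpace 𝓘(ℝ, E) x,
        u ∈ D x ↔ (mvfderiv 𝓘(ℝ, E) e x u).1 = A (e x) (mvfderiv 𝓘(ℝ, E) e x u).2 := by
  let H (x : M) : W₁ × W₂ →L[ℝ] W₁ × W₂ := mvfderiv 𝓘(ℝ, E) e x ∘L (D x)ᗮ.starProjection ∘L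
    (mvfderiv 𝓘(ℝ, E) e x).inverse
  let V (x : M) : W₁ × W₂ →L[ℝ] W₁ × W₂ := mvfderiv 𝓘(ℝ, E) e x ∘L (D x).starProjection ∘L
    (mvfderiv 𝓘(ℝ, E) e x).inverse
  have hH {x : M} (hx : x ∈ e.source) (u : TangentSpace 𝓘(ℝ, E) x) : H x (mvfderiv 𝓘(ℝ, E) e x u) =
      mvfderiv 𝓘(ℝ, E) e x ((D x)ᗮ.starProjection u) := by
    simp [H, (he.isInvertible hx).inverse_apply_self]
  have hV {x : M} (hx : x ∈ e.source) (u : TangentSpace 𝓘(ℝ, E) x) : V x (mvfderiv 𝓘(ℝ, E) e x u) =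
      mvfderiv 𝓘(ℝ, E) e x ((D x).starProjection u) := by
    simp [V, (he.isInvertible hx).inverse_apply_self]
  have sH {x : M} (hx : x ∈ e.source) :
      ContMDiffAt 𝓘(ℝ, E) 𝓘(ℝ, W₁ × W₂ →L[ℝ] W₁ × W₂) ∞ H x :=
    contMDiffAt_of_forall_apply fun c ↦ contMDiffAt_mvfderiv_apply (he.contMDiffAt hx)
      (hD _ x (he.contMDiffAt_coordField hx c)).2
  have sV {x : M} (hx : x ∈ e.source) :
      ContMDiffAt 𝓘(ℝ, E) 𝓘(ℝ, W₁ × W₂ →L[ℝ] W₁ × W₂) ∞ V x :=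
    contMDiffAt_of_forall_apply fun c ↦ contMDiffAt_mvfderiv_apply (he.contMDiffAt hx)
      (hD _ x (he.contMDiffAt_coordField hx c)).1
  let P₁ (x : M) : W₁ × W₂ →L[ℝ] W₁ × W₂ :=
    (ContinuousLinearMap.inl ℝ W₁ W₂ ∘L ContinuousLinearMap.fst ℝ W₁ W₂) ∘L H x
  let P₂ : W₁ × W₂ →L[ℝ] W₁ × W₂ :=
    ContinuousLinearMap.inr ℝ W₁ W₂ ∘L ContinuousLinearMap.snd ℝ W₁ W₂
  -- Both maps are the identity at `p`, hence invertible nearby. `T` is used to solve for `A`; `Q`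
  -- is used to see that a horizontal vector with zero `W₁`-component is zero.
  let T (x : M) : W₁ × W₂ →L[ℝ] W₁ × W₂ := P₁ x + P₂
  let Q (x : M) : W₁ × W₂ →L[ℝ] W₁ × W₂ := P₁ x + P₂ ∘L V x
  have hT (x : M) (c : W₁ × W₂) : T x c = ((H x c).1, c.2) := by simp [T, P₁, P₂]
  have hQ (x : M) (c : W₁ × W₂) : Q x c = ((H x c).1, (V x c).2) := by simp [Q, P₁, P₂]
  have sP₁ {x : M} (hx : x ∈ e.source) :
      ContMDiffAt 𝓘(ℝ, E) 𝓘(ℝ, W₁ × W₂ →L[ℝ] W₁ × W₂) ∞ P₁ x := contMDiffAt_const.clm_comp (sH hx)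
  have sT {x : M} (hx : x ∈ e.source) :
      ContMDiffAt 𝓘(ℝ, E) 𝓘(ℝ, W₁ × W₂ →L[ℝ] W₁ × W₂) ∞ T x := (sP₁ hx).add contMDiffAt_const
  have sQ {x : M} (hx : x ∈ e.source) :
      ContMDiffAt 𝓘(ℝ, E) 𝓘(ℝ, W₁ × W₂ →L[ℝ] W₁ × W₂) ∞ Q x :=
    (sP₁ hx).add (contMDiffAt_const.clm_comp (sV hx))
  have hpH (c : W₁ × W₂) : (H p c).1 = c.1 ∧ (V p c).2 = c.2 := by
    obtain ⟨u, rfl⟩ : ∃ u, mvfderiv 𝓘(ℝ, E) e p u = c := ⟨_, he.mvfderiv_coordField hp c⟩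
    rw [hH hp, hV hp]
    have h1 := (D p).starProjection_add_starProjection_orthogonal u
    have h2 := congrArg (mvfderiv 𝓘(ℝ, E) e p) h1
    rw [map_add] at h2
    have h3 := hep₁ _ ((D p).starProjection_apply_mem u)
    have h4 := hep₂ _ ((D p)ᗮ.starProjection_apply_mem u)
    rw [← h2, Prod.fst_add, Prod.snd_add, h3, h4, zero_add, add_zero]
    exact ⟨rfl, rfl⟩
  have hpT : T p = ContinuousLinearMap.id ℝ _ := by
    refine ContinuousLinearMap.ext fun c ↦ ?_
    rw [hT, (hpH c).1]
    rfl
  have hpQ : Q p = ContinuousLinearMap.id ℝ _ := by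
    refine ContinuousLinearMap.ext fun c ↦ ?_
    rw [hQ, (hpH c).1, (hpH c).2]
    rfl
  obtain ⟨U, hU, hUo, hpU⟩ := eventually_nhds_iff.1
    ((eventually_isInvertible (sT hp).continuousAt hpT).and
      (eventually_isInvertible (sQ hp).continuousAt hpQ))
  let A (z : W₁ × W₂) : W₂ →L[ℝ] W₁ := ContinuousLinearMap.fst ℝ W₁ W₂ ∘L
    (T (e.symm z)).inverse ∘L ContinuousLinearMap.inr ℝ W₁ W₂
  have hA {x : M} (hx : x ∈ e.source) (hxU : x ∈ U) (η : W₂) :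
      T x (A (e x) η, η) = (0, η) := by
    have h1 := (hU x hxU).1.self_apply_inverse (0, η)
    have h2 : ((T x).inverse (0, η)).2 = η := by
      rw [hT] at h1
      exact congrArg Prod.snd h1
    have h3 : A (e x) η = ((T x).inverse (0, η)).1 := by simp [A, e.left_inv hx]
    conv_lhs => rw [h3]
    conv_lhs =>
      enter [2, 2]
      rw [← h2]
    exact h1
  refine ⟨U, A, hUo, hpU, fun x hx ↦ ?_, fun x hx u ↦ ?_⟩
  · have h1 : ContDiffAt ℝ ∞ (fun z ↦ T (e.symm z)) (e x) := by
      rw [← contMDiffAt_iff_contDiffAt]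
      refine ContMDiffAt.comp (I' := 𝓘(ℝ, E)) (g := T) (e x) ?_
        (he.contMDiffAt_symm (e.map_source hx.1))
      rw [e.left_inv hx.1]
      exact sT hx.1
    have h2 : ContDiffAt ℝ ∞ ContinuousLinearMap.inverse (T (e.symm (e x))) := by
      rw [e.left_inv hx.1]
      obtain ⟨g, hg⟩ := (hU _ hx.2).1
      rw [← hg]
      exact contDiffAt_map_inverse g
    have h3 : ContDiffAt ℝ ∞ (fun z ↦ (T (e.symm z)).inverse) (e x) :=
      ContDiffAt.comp (g := ContinuousLinearMap.inverse) (e x) h2 h1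
    exact contDiffAt_const.clm_comp (h3.clm_comp contDiffAt_const)
  · have hxs : x ∈ e.source := hx.1
    have h1 : u ∈ D x ↔ (H x (mvfderiv 𝓘(ℝ, E) e x u)).1 = 0 := by
      rw [hH hxs]
      have h0 : u ∈ D x ↔ (D x)ᗮ.starProjection u = 0 := by
        rw [Submodule.starProjection_apply, Submodule.coe_eq_zero,
          Submodule.orthogonalProjectionOnto_eq_zero_iff, Submodule.orthogonal_orthogonal]
      rw [h0]
      refine ⟨fun h ↦ by rw [h, map_zero]; rfl, fun h ↦ ?_⟩
      have h00 : (D x).starProjection ((D x)ᗮ.starProjection u) = 0 := by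
        rw [Submodule.starProjection_apply, Submodule.coe_eq_zero,
          Submodule.orthogonalProjectionOnto_eq_zero_iff]
        exact (D x)ᗮ.starProjection_apply_mem u
      -- `Q` kills the image of `ℋu`: its first entry is zero by hypothesis and its second because
      -- `𝒱ℋu = 0`.
      refine he.mvfderiv_injective hxs ((hU x hx.2).2.injective ?_)
      rw [map_zero, map_zero, hQ, hH hxs, hV hxs, Submodule.starProjection_eq_self_iff.2
        ((D x)ᗮ.starProjection_apply_mem u), h, h00, map_zero]
      rfl
    rw [h1]
    constructor
    · intro h
      have h2 : T x (mvfderiv 𝓘(ℝ, E) e x u) = T x (A (e x) (mvfderiv 𝓘(ℝ, E) e x u).2,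
          (mvfderiv 𝓘(ℝ, E) e x u).2) := by
        rw [hA hxs hx.2, hT, h]
      have h3 := (hU x hx.2).1.injective h2
      exact (Prod.ext_iff.1 h3).1
    · intro h
      have h2 := hA hxs hx.2 (mvfderiv 𝓘(ℝ, E) e x u).2
      rw [← h, hT] at h2
      exact congrArg Prod.fst h2

/-- A smooth distribution is, in a suitable chart near a given point, a smooth family of graphs. -/
theorem exists_graph_chart (hD : IsSmoothSplitting D) (p : M) :
    ∃ (e : OpenPartialHomeomorph M (EuclideanSpace ℝ (Fin (Module.finrank ℝ (D p)ᗮ)) ×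
        EuclideanSpace ℝ (Fin (Module.finrank ℝ (D p)))))
      (A : EuclideanSpace ℝ (Fin (Module.finrank ℝ (D p)ᗮ)) ×
        EuclideanSpace ℝ (Fin (Module.finrank ℝ (D p))) →
        EuclideanSpace ℝ (Fin (Module.finrank ℝ (D p))) →L[ℝ]
          EuclideanSpace ℝ (Fin (Module.finrank ℝ (D p)ᗮ))),
      IsSmoothChart E e ∧ p ∈ e.source ∧ e p = 0 ∧ ContDiffOn ℝ ∞ A e.target ∧
      ∀ x ∈ e.source, ∀ u : TangentSpace 𝓘(ℝ, E) x,
        u ∈ D x ↔ (mvfderiv 𝓘(ℝ, E) e x u).1 = A (e x) (mvfderiv 𝓘(ℝ, E) e x u).2 := by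
  obtain ⟨e, he, hp, hep, hep₁, hep₂⟩ := exists_adapted_chart D p
  obtain ⟨U, A, hU, hpU, hA, hAD⟩ := eventually_graph hD he hp hep₁ hep₂
  refine ⟨e.restrOpen U hU, A, he.restrOpen hU, ⟨hp, hpU⟩, hep, fun z hz ↦ ?_, hAD⟩
  have := hA (e.symm z) ⟨e.map_target hz.1, hz.2⟩
  rw [e.right_inv hz.1] at this
  exact this.contDiffWithinAt

end GraphChart

/-! ### Totally geodesic distributions are integrable -/

section LocalFrobenius

variable {E : Type*} [NormedAddCommGroup E] [NormedSpace ℝ E] [FiniteDimensional ℝ E]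
  {M : Type*} [TopologicalSpace M] [ChartedSpace E M] [IsManifold 𝓘(ℝ, E) ∞ M]
  [RiemannianBundle (fun x : M ↦ TangentSpace 𝓘(ℝ, E) x)]
  [IsContMDiffRiemannianBundle 𝓘(ℝ, E) ∞ E (fun x : M ↦ TangentSpace 𝓘(ℝ, E) x)]
  {D : SubspaceField E M}

/-- `[X, Y] = ∇_X Y - ∇_Y X`, in Koszul form: both Koszul expressions vanish against a vector
orthogonal to `D`. -/
theorem mlieBracket_mem_of_isTotallyGeodesic [T2Space M] (hD : IsTotallyGeodesic D) {U : Set M}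
    (hU : IsOpen U) {X Y : VField E M} (hX : SmoothFieldOn X U) (hY : SmoothFieldOn Y U)
    (hXD : ∀ y ∈ U, X y ∈ D y) (hYD : ∀ y ∈ U, Y y ∈ D y) {x : M} (hx : x ∈ U) :
    VectorField.mlieBracket 𝓘(ℝ, E) X Y x ∈ D x := by
  rw [← (D x).orthogonal_orthogonal, Submodule.mem_orthogonal]
  intro w hw
  have hZ := FiberBundle.mdifferentiableAt_extend 𝓘(ℝ, E) E w
  have hZx : FiberBundle.extend E w x = w := by simp
  have h1 := koszul_sub_koszul_swap X Y (FiberBundle.extend E w) x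
  rw [koszul_eq_zero_of_isTotallyGeodesic hD hU hX hY hXD hYD hx hZ (by rwa [hZx]),
    koszul_eq_zero_of_isTotallyGeodesic hD hU hY hX hYD hXD hx hZ (by rwa [hZx]), hZx] at h1
  rw [real_inner_comm]
  linarith

section

variable {W₁ W₂ : Type u} [NormedAddCommGroup W₁] [NormedSpace ℝ W₁] [FiniteDimensional ℝ W₁]
  [NormedAddCommGroup W₂] [NormedSpace ℝ W₂] [FiniteDimensional ℝ W₂]

/-- The fields with chart components `(A η, η)` span `D`. The bracket of two of them has second
component zero, so membership in the graph forces its first component, the difference of the two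
sides, to vanish. -/
theorem fderiv_graph_symmetric [T2Space M] (hD : IsTotallyGeodesic D)
    {e : OpenPartialHomeomorph M (W₁ × W₂)} {A : W₁ × W₂ → W₂ →L[ℝ] W₁} (he : IsSmoothChart E e)
    (hA : ContDiffOn ℝ ∞ A e.target) (hgraph : ∀ x ∈ e.source, ∀ u : TangentSpace 𝓘(ℝ, E) x,
      u ∈ D x ↔ (mvfderiv 𝓘(ℝ, E) e x u).1 = A (e x) (mvfderiv 𝓘(ℝ, E) e x u).2)
    {z : W₁ × W₂} (hz : z ∈ e.target) (y η : W₂) :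
    fderiv ℝ A z (A z y, y) η = fderiv ℝ A z (A z η, η) y := by
  obtain ⟨x, hx, rfl⟩ : ∃ x ∈ e.source, e x = z := ⟨_, e.map_target hz, e.right_inv hz⟩
  have hAz {y : M} (hy : y ∈ e.source) : ContDiffAt ℝ ∞ A (e y) :=
    hA.contDiffAt (e.open_target.mem_nhds (e.map_source hy))
  let Z (η : W₂) : VField E M := fun y ↦ (mvfderiv 𝓘(ℝ, E) e y).inverse (A (e y) η, η)
  have hZ (η : W₂) {y : M} (hy : y ∈ e.source) : mvfderiv 𝓘(ℝ, E) e y (Z η y) = (A (e y) η, η) :=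
    (he.isInvertible hy).self_apply_inverse _
  have sZ (η : W₂) : SmoothFieldOn (Z η) e.source := fun y hy ↦
    (he.contMDiffAt_inverse_apply hy (V := fun z ↦ (A z η, η))
      (((hAz hy).clm_apply contDiffAt_const).prodMk contDiffAt_const)).contMDiffWithinAt
  have mZ (η : W₂) : MDiffAt (T% (Z η)) x :=
    ((sZ η).contMDiffAt (e.open_source.mem_nhds hx)).mdifferentiableAt (by simp)
  have ZD (η : W₂) : ∀ y ∈ e.source, Z η y ∈ D y := fun y hy ↦ by
    rw [hgraph y hy, hZ η hy]
  have hder (y η : W₂) : mvfderiv 𝓘(ℝ, E) (fun y ↦ mvfderiv 𝓘(ℝ, E) e y (Z η y)) x (Z y x) =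
      (fderiv ℝ A (e x) (A (e x) y, y) η, 0) := by
    have h1 : (fun y ↦ mvfderiv 𝓘(ℝ, E) e y (Z η y)) =ᶠ[nhds x] fun y ↦ (A (e y) η, η) := by
      filter_upwards [e.open_source.mem_nhds hx] with y hy using hZ η hy
    have h2 : HasFDerivAt (fun z ↦ (A z η, η)) (((fderiv ℝ A (e x)).flip η).prod 0) (e x) := by
      have h3 := (((hAz hx).differentiableAt (by simp)).hasFDerivAt.clm_apply
        (hasFDerivAt_const η (e x))).prodMk (hasFDerivAt_const η (e x))
      simpa using h3
    rw [mvfderiv_congr h1, mvfderiv_comp_fderiv (f := e) (g := fun z ↦ (A z η, η))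
      h2.differentiableAt (he.mdifferentiableAt hx), h2.fderiv, hZ y hx]
    rfl
  have hb := mlieBracket_mem_of_isTotallyGeodesic hD e.open_source (sZ y) (sZ η) (ZD y) (ZD η) hx
  rw [hgraph x hx, mvfderiv_mlieBracket (he.contMDiffAt hx) (mZ y) (mZ η), hder, hder] at hb
  simpa [sub_eq_zero] using hb

/-- The `W₁`-component of the straightened chart works: the differential of `Ψ` carries `0 × W₂`
onto the graph of `A`, which is `D`. -/
theorem exists_submersion_of_graph [T2Space M] (hD : IsTotallyGeodesic D)
    {e : OpenPartialHomeomorph M (W₁ × W₂)} {A : W₁ × W₂ → W₂ →L[ℝ] W₁} (he : IsSmoothChart E e)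
    {p : M} (hp : p ∈ e.source) (hep : e p = 0)
    (hA : ContDiffOn ℝ ∞ A e.target) (hgraph : ∀ x ∈ e.source, ∀ u : TangentSpace 𝓘(ℝ, E) x,
      u ∈ D x ↔ (mvfderiv 𝓘(ℝ, E) e x u).1 = A (e x) (mvfderiv 𝓘(ℝ, E) e x u).2) :
    ∃ (f : M → W₁) (U : Set M), IsOpen U ∧ p ∈ U ∧ ContMDiffOn 𝓘(ℝ, E) 𝓘(ℝ, W₁) ∞ f U ∧
      ∀ x ∈ U, ∀ u, u ∈ D x ↔ mvfderiv 𝓘(ℝ, E) f x u = 0 := by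
  obtain ⟨Ψ, h0, hΨ0, hΨt, hΨ, hΨ', -, hΨd⟩ := exists_straightening e.open_target
    (hep ▸ e.map_source hp) hA fun z hz y η ↦ fderiv_graph_symmetric hD he hA hgraph hz y η
  have h0t : (0 : W₁ × W₂) ∈ Ψ.target := hΨ0 ▸ Ψ.map_source h0
  have hg : IsSmoothChart E (e ≫ₕ Ψ.symm) := he.trans hΨ' hΨ
  refine ⟨fun x ↦ ((e ≫ₕ Ψ.symm) x).1, (e ≫ₕ Ψ.symm).source, (e ≫ₕ Ψ.symm).open_source,
    ⟨hp, by simpa [hep] using h0t⟩, contDiff_fst.contMDiff.comp_contMDiffOn hg.smooth,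
    fun x hx u ↦ ?_⟩
  have hxs : x ∈ e.source := hx.1
  have hxt : e x ∈ Ψ.target := hx.2
  have hq := Ψ.map_target hxt
  have dΨ : DifferentiableAt ℝ Ψ (Ψ.symm (e x)) :=
    (hΨ.contDiffAt (Ψ.open_source.mem_nhds hq)).differentiableAt (by simp)
  have hde (u : TangentSpace 𝓘(ℝ, E) x) : mvfderiv 𝓘(ℝ, E) e x u =
      fderiv ℝ Ψ (Ψ.symm (e x)) (mvfderiv 𝓘(ℝ, E) (e ≫ₕ Ψ.symm) x u) := by
    refine Eq.trans (mvfderiv_congr ?_ u)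
      (mvfderiv_comp_fderiv (f := e ≫ₕ Ψ.symm) (g := Ψ) dΨ (hg.mdifferentiableAt hx) u)
    filter_upwards [(e ≫ₕ Ψ.symm).open_source.mem_nhds hx] with y hy
    exact (Ψ.right_inv hy.2).symm
  have hval := fun η ↦ hΨd _ hq η
  rw [Ψ.right_inv hxt] at hval
  rw [mvfderiv_fst (hg.mdifferentiableAt hx), hgraph x hxs]
  constructor
  · intro h
    have h1 : mvfderiv 𝓘(ℝ, E) e x u =
        fderiv ℝ Ψ (Ψ.symm (e x)) (0, (mvfderiv 𝓘(ℝ, E) e x u).2) := by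
      rw [hval, ← h]
    obtain ⟨v, hv⟩ : ∃ v, mvfderiv 𝓘(ℝ, E) (e ≫ₕ Ψ.symm) x v = (0, (mvfderiv 𝓘(ℝ, E) e x u).2) :=
      ⟨_, hg.mvfderiv_coordField hx _⟩
    have hde' := hde v
    rw [hv, ← h1] at hde'
    rw [← he.mvfderiv_injective hxs hde', hv]
  · intro h
    have h1 : mvfderiv 𝓘(ℝ, E) (e ≫ₕ Ψ.symm) x u =
        (0, (mvfderiv 𝓘(ℝ, E) (e ≫ₕ Ψ.symm) x u).2) := Prod.ext h rfl
    rw [hde, h1, hval]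

end

theorem exists_submersion_of_isTotallyGeodesic [T2Space M] (hD : IsSmoothSplitting D)
    (hDt : IsTotallyGeodesic D) (p : M) :
    ∃ (f : M → EuclideanSpace ℝ (Fin (Module.finrank ℝ (D p)ᗮ))) (U : Set M), IsOpen U ∧ p ∈ U ∧
      ContMDiffOn 𝓘(ℝ, E) 𝓘(ℝ, EuclideanSpace ℝ (Fin (Module.finrank ℝ (D p)ᗮ))) ∞ f U ∧
      ∀ x ∈ U, ∀ u, u ∈ D x ↔ mvfderiv 𝓘(ℝ, E) f x u = 0 := by
  obtain ⟨e, A, he, hp, hep, hA, hgraph⟩ := exists_graph_chart hD p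
  exact exists_submersion_of_graph hDt he hp hep hA hgraph

end LocalFrobenius

/-! ### Splitting the metric -/

section Converse

variable {E : Type*} [NormedAddCommGroup E] [NormedSpace ℝ E] [FiniteDimensional ℝ E]
  {M : Type*} [TopologicalSpace M] [ChartedSpace E M] [IsManifold 𝓘(ℝ, E) ∞ M]
  [RiemannianBundle (fun x : M ↦ TangentSpace 𝓘(ℝ, E) x)]
  [IsContMDiffRiemannianBundle 𝓘(ℝ, E) ∞ E (fun x : M ↦ TangentSpace 𝓘(ℝ, E) x)]
  {D : SubspaceField E M}

/-- The submersion with kernel `Dᗮ` gives the first coordinate, the one with kernel `D` the second.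
The joint differential is injective since `D` meets `Dᗮ` only in zero, and the dimensions match. -/
theorem exists_product_chart [T2Space M] (hD : IsSmoothSplitting D) (hDt : IsTotallyGeodesic D)
    (hDt' : IsTotallyGeodesic (fun x ↦ (D x)ᗮ)) (p : M) :
    ∃ (a b : ℕ) (e : OpenPartialHomeomorph M
        (EuclideanSpace ℝ (Fin a) × EuclideanSpace ℝ (Fin b))),
      IsSmoothChart E e ∧ p ∈ e.source ∧ ∀ x ∈ e.source, ∀ u : TangentSpace 𝓘(ℝ, E) x,
        (u ∈ D x ↔ (mvfderiv 𝓘(ℝ, E) e x u).2 = 0) ∧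
        (u ∈ (D x)ᗮ ↔ (mvfderiv 𝓘(ℝ, E) e x u).1 = 0) := by
  obtain ⟨f₂, U₂, hU₂, hp₂, hf₂, hk₂⟩ := exists_submersion_of_isTotallyGeodesic hD hDt p
  obtain ⟨f₁, U₁, hU₁, hp₁, hf₁, hk₁⟩ :=
    exists_submersion_of_isTotallyGeodesic hD.orthogonal hDt' p
  have hf : ContMDiffOn 𝓘(ℝ, E) 𝓘(ℝ, _ × _) ∞ (fun x ↦ (f₁ x, f₂ x)) (U₁ ∩ U₂) :=
    (hf₁.mono Set.inter_subset_left).prodMk_space (hf₂.mono Set.inter_subset_right)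
  have hU := hU₁.inter hU₂
  have hpU : p ∈ U₁ ∩ U₂ := ⟨hp₁, hp₂⟩
  have hdiff {x : M} (hx : x ∈ U₁ ∩ U₂) : MDifferentiableAt 𝓘(ℝ, E) 𝓘(ℝ, _ × _)
      (fun x ↦ (f₁ x, f₂ x)) x := (hf.contMDiffAt (hU.mem_nhds hx)).mdifferentiableAt (by simp)
  have h1 {x : M} (hx : x ∈ U₁ ∩ U₂) (u : TangentSpace 𝓘(ℝ, E) x) :
      u ∈ (D x)ᗮ ↔ (mvfderiv 𝓘(ℝ, E) (fun x ↦ (f₁ x, f₂ x)) x u).1 = 0 := by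
    rw [hk₁ x hx.1, ← mvfderiv_fst (hdiff hx)]
  have h2 {x : M} (hx : x ∈ U₁ ∩ U₂) (u : TangentSpace 𝓘(ℝ, E) x) :
      u ∈ D x ↔ (mvfderiv 𝓘(ℝ, E) (fun x ↦ (f₁ x, f₂ x)) x u).2 = 0 := by
    rw [hk₂ x hx.2, ← mvfderiv_snd (hdiff hx)]
  have hinj : Function.Injective (mvfderiv 𝓘(ℝ, E) (fun x ↦ (f₁ x, f₂ x)) p).toLinearMap := by
    rw [injective_iff_map_eq_zero]
    intro u hu
    have hu' : mvfderiv 𝓘(ℝ, E) (fun x ↦ (f₁ x, f₂ x)) p u = 0 := hu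
    have hu1 := (h1 hpU u).2 (by rw [hu']; rfl)
    have hu2 := (h2 hpU u).2 (by rw [hu']; rfl)
    exact inner_self_eq_zero.1 ((Submodule.mem_orthogonal _ _).1 hu1 u hu2)
  have hinv : (mvfderiv 𝓘(ℝ, E) (fun x ↦ (f₁ x, f₂ x)) p).IsInvertible :=
    ⟨(LinearEquiv.ofInjectiveOfFinrankEq _ hinj (by
      rw [Module.finrank_prod, finrank_euclideanSpace_fin, finrank_euclideanSpace_fin, add_comm,
        Submodule.finrank_add_finrank_orthogonal])).toContinuousLinearEquiv,
      ContinuousLinearMap.ext fun _ ↦ rfl⟩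
  obtain ⟨e, he, hpe, heU, hef⟩ := exists_smoothChart_of_isInvertible hU hf hpU hinv
  refine ⟨_, _, e, he, hpe, fun x hx u ↦ ?_⟩
  have : mvfderiv 𝓘(ℝ, E) e x u = mvfderiv 𝓘(ℝ, E) (fun x ↦ (f₁ x, f₂ x)) x u :=
    mvfderiv_congr (Filter.eventuallyEq_of_mem (e.open_source.mem_nhds hx) hef) u
  rw [this]
  exact ⟨h2 (heU hx) u, h1 (heU hx) u⟩

/-- With vanishing brackets and with `g(X, Z)` and `g(Y, Z)` zero, only `-Z g(X, Y)` is left in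
Koszul's expression. -/
theorem mvfderiv_inner_eq_zero_of_isTotallyGeodesic [T2Space M] (hD : IsTotallyGeodesic D)
    {U : Set M} (hU : IsOpen U) {X Y Z : VField E M} (hX : SmoothFieldOn X U)
    (hY : SmoothFieldOn Y U) (hZ : SmoothFieldOn Z U) (hXD : ∀ y ∈ U, X y ∈ D y)
    (hYD : ∀ y ∈ U, Y y ∈ D y) (hZD : ∀ y ∈ U, Z y ∈ (D y)ᗮ) {x : M} (hx : x ∈ U)
    (hXY : VectorField.mlieBracket 𝓘(ℝ, E) X Y x = 0)
    (hXZ : VectorField.mlieBracket 𝓘(ℝ, E) X Z x = 0)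
    (hYZ : VectorField.mlieBracket 𝓘(ℝ, E) Y Z x = 0) :
    mvfderiv 𝓘(ℝ, E) (fun y ↦ (inner ℝ (X y) (Y y) : ℝ)) x (Z x) = 0 := by
  have h1 := koszul_eq_zero_of_isTotallyGeodesic hD hU hX hY hXD hYD hx
    ((hZ.contMDiffAt (hU.mem_nhds hx)).mdifferentiableAt (by simp)) (hZD x hx)
  have orth {V : VField E M} (hV : ∀ y ∈ U, V y ∈ D y) :
      (fun y ↦ (inner ℝ (V y) (Z y) : ℝ)) =ᶠ[nhds x] fun _ ↦ 0 := by
    filter_upwards [hU.mem_nhds hx] with y hy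
    exact (Submodule.mem_orthogonal _ _).1 (hZD y hy) _ (hV y hy)
  rw [koszul, mvfderiv_eq_zero (orth hXD), mvfderiv_eq_zero (orth hYD), hXY, hXZ, hYZ] at h1
  simpa using h1

section Gram

variable {W : Type*} [NormedAddCommGroup W] [NormedSpace ℝ W]

/-- The components of the metric in the chart `e`. -/
def gram (e : OpenPartialHomeomorph M W) (z : W) : W →L[ℝ] W →L[ℝ] ℝ :=
  (innerSL ℝ : TangentSpace 𝓘(ℝ, E) (e.symm z) →L[ℝ] TangentSpace 𝓘(ℝ, E) (e.symm z) →L[ℝ] ℝ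
    ).bilinearComp (mvfderiv 𝓘(ℝ, E) e (e.symm z)).inverse
    (mvfderiv 𝓘(ℝ, E) e (e.symm z)).inverse

theorem gram_apply (e : OpenPartialHomeomorph M W) (z c c' : W) :
    gram (E := E) e z c c' = inner ℝ ((coordField e c : VField E M) (e.symm z))
      (coordField e c' (e.symm z)) := rfl

variable {e : OpenPartialHomeomorph M W}

theorem gram_symm (z c c' : W) : gram (E := E) e z c c' = gram (E := E) e z c' c := by
  rw [gram_apply, gram_apply, real_inner_comm]

theorem gram_pos (he : IsSmoothChart E e) {z c : W} (hz : z ∈ e.target) (hc : c ≠ 0) :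
    0 < gram (E := E) e z c c := by
  rw [gram_apply, real_inner_self_pos]
  intro h
  have h1 := he.mvfderiv_coordField (e.map_target hz) c
  rw [h, map_zero] at h1
  exact hc h1.symm

theorem gram_mvfderiv (he : IsSmoothChart E e) {x : M} (hx : x ∈ e.source)
    (u v : TangentSpace 𝓘(ℝ, E) x) :
    gram (E := E) e (e x) (mvfderiv 𝓘(ℝ, E) e x u) (mvfderiv 𝓘(ℝ, E) e x v) = inner ℝ u v := by
  -- The point `e.symm (e x)` equals `x` only propositionally, so the base point is generalised
  -- before substituting.
  have key : ∀ y (hy : y = x), (inner ℝ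
      ((coordField e (mvfderiv 𝓘(ℝ, E) e x u) : VField E M) y)
      (coordField e (mvfderiv 𝓘(ℝ, E) e x v) y) : ℝ) = inner ℝ u v := by
    rintro _ rfl
    simp [coordField, (he.isInvertible hx).inverse_apply_self]
  exact key _ (e.left_inv hx)

theorem contDiffOn_gram_apply (he : IsSmoothChart E e) (c c' : W) :
    ContDiffOn ℝ ∞ (fun z ↦ gram (E := E) e z c c') e.target := by
  rw [← contMDiffOn_iff_contDiffOn]
  have h : ContMDiffOn 𝓘(ℝ, E) 𝓘(ℝ) ∞
      (fun y ↦ (inner ℝ ((coordField e c : VField E M) y) (coordField e c' y) : ℝ)) e.source :=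
    fun y hy ↦ (contMDiffAt_inner (he.contMDiffAt_coordField hy c)
      (he.contMDiffAt_coordField hy c')).contMDiffWithinAt
  exact h.comp he.smooth_symm fun z hz ↦ e.map_target hz

theorem fderiv_gram_eq_zero [T2Space M] (he : IsSmoothChart E e) (hD : IsTotallyGeodesic D)
    {c c' d : W} (hc : ∀ x ∈ e.source, coordField e c x ∈ D x)
    (hc' : ∀ x ∈ e.source, coordField e c' x ∈ D x)
    (hd : ∀ x ∈ e.source, coordField e d x ∈ (D x)ᗮ) {z : W} (hz : z ∈ e.target) :
    fderiv ℝ (fun z ↦ gram (E := E) e z c c') z d = 0 := by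
  obtain ⟨x, hx, rfl⟩ : ∃ x ∈ e.source, e x = z := ⟨_, e.map_target hz, e.right_inv hz⟩
  have hs (c : W) : SmoothFieldOn (coordField e c : VField E M) e.source := fun y hy ↦
    (he.contMDiffAt_coordField hy c).contMDiffWithinAt
  have h1 := mvfderiv_inner_eq_zero_of_isTotallyGeodesic hD e.open_source (hs c) (hs c') (hs d)
    hc hc' hd hx (he.mlieBracket_coordField hx _ _) (he.mlieBracket_coordField hx _ _)
    (he.mlieBracket_coordField hx _ _)
  have h2 := mvfderiv_comp_fderiv (f := e) (g := fun z ↦ gram (E := E) e z c c')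
    (((contDiffOn_gram_apply he c c').contDiffAt (e.open_target.mem_nhds hz)).differentiableAt
      (by simp)) (he.mdifferentiableAt hx) (coordField e d x)
  rw [he.mvfderiv_coordField hx] at h2
  rw [← h2, ← h1]
  refine mvfderiv_congr ?_ _
  filter_upwards [e.open_source.mem_nhds hx] with y hy
  rw [gram_apply, e.left_inv hy]

end Gram

section

variable {W₁ W₂ : Type*} [NormedAddCommGroup W₁] [NormedSpace ℝ W₁] [NormedAddCommGroup W₂]
  [NormedSpace ℝ W₂]

/-- The metric induced on the slice `W₁ × {y}` in the chart `e`. -/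
def gramFst (e : OpenPartialHomeomorph M (W₁ × W₂)) (y : W₂) (v : W₁) : W₁ →L[ℝ] W₁ →L[ℝ] ℝ :=
  (gram (E := E) e (v, y)).bilinearComp (ContinuousLinearMap.inl ℝ W₁ W₂)
    (ContinuousLinearMap.inl ℝ W₁ W₂)

/-- The metric induced on the slice `{v} × W₂` in the chart `e`. -/
def gramSnd (e : OpenPartialHomeomorph M (W₁ × W₂)) (v : W₁) (y : W₂) : W₂ →L[ℝ] W₂ →L[ℝ] ℝ :=
  (gram (E := E) e (v, y)).bilinearComp (ContinuousLinearMap.inr ℝ W₁ W₂)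
    (ContinuousLinearMap.inr ℝ W₁ W₂)

theorem gramFst_apply (e : OpenPartialHomeomorph M (W₁ × W₂)) (y : W₂) (v ξ ξ' : W₁) :
    gramFst (E := E) e y v ξ ξ' = gram (E := E) e (v, y) (ξ, 0) (ξ', 0) := rfl

theorem gramSnd_apply (e : OpenPartialHomeomorph M (W₁ × W₂)) (v : W₁) (y η η' : W₂) :
    gramSnd (E := E) e v y η η' = gram (E := E) e (v, y) (0, η) (0, η') := rfl

end

/-- Each diagonal block has zero derivative in the other factor's directions, so connectedness of
that factor lets it be evaluated at `y₀` or `v₀`. The mixed blocks vanish by orthogonality. -/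
theorem gram_eq_add_of_product [T2Space M] {W₁ W₂ : Type*} [NormedAddCommGroup W₁]
    [NormedSpace ℝ W₁] [NormedAddCommGroup W₂] [NormedSpace ℝ W₂]
    {e : OpenPartialHomeomorph M (W₁ × W₂)} (he : IsSmoothChart E e) (hDt : IsTotallyGeodesic D)
    (hDt' : IsTotallyGeodesic (fun x ↦ (D x)ᗮ)) {V₁ : Set W₁} {V₂ : Set W₂} (oV₁ : IsOpen V₁)
    (cV₁ : IsPreconnected V₁) (oV₂ : IsOpen V₂) (cV₂ : IsPreconnected V₂)
    (het : e.target = V₁ ×ˢ V₂) (hker : ∀ x ∈ e.source, ∀ u : TangentSpace 𝓘(ℝ, E) x,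
        (u ∈ D x ↔ (mvfderiv 𝓘(ℝ, E) e x u).2 = 0) ∧
        (u ∈ (D x)ᗮ ↔ (mvfderiv 𝓘(ℝ, E) e x u).1 = 0))
    {v₀ : W₁} (hv₀ : v₀ ∈ V₁) {y₀ : W₂} (hy₀ : y₀ ∈ V₂) {z : W₁ × W₂} (hz : z ∈ V₁ ×ˢ V₂)
    (c c' : W₁ × W₂) :
    gram (E := E) e z c c' = gram (E := E) e (z.1, y₀) (c.1, 0) (c'.1, 0) +
      gram (E := E) e (v₀, z.2) (0, c.2) (0, c'.2) := by
  have hc₁ (ξ : W₁) : ∀ x ∈ e.source, coordField e (ξ, 0) x ∈ D x :=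
    fun x hx ↦ by rw [(hker x hx _).1, he.mvfderiv_coordField hx]
  have hc₂ (η : W₂) : ∀ x ∈ e.source, coordField e (0, η) x ∈ (D x)ᗮ :=
    fun x hx ↦ by rw [(hker x hx _).2, he.mvfderiv_coordField hx]
  have hc₁' (ξ : W₁) : ∀ x ∈ e.source, coordField e (ξ, 0) x ∈ (D x)ᗮᗮ :=
    fun x hx ↦ by
      rw [Submodule.orthogonal_orthogonal]
      exact hc₁ ξ x hx
  let G := gram (E := E) e
  have sG (c c') : ContDiffOn ℝ ∞ (fun z ↦ G z c c') (V₁ ×ˢ V₂) :=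
    het ▸ contDiffOn_gram_apply he c c'
  have dG (c c') {z} (hz : z ∈ V₁ ×ˢ V₂) : DifferentiableAt ℝ (fun z ↦ G z c c') z :=
    ((sG c c').contDiffAt ((oV₁.prod oV₂).mem_nhds hz)).differentiableAt (by simp)
  have const₁ (ξ ξ' : W₁) {v y y'} (hv : v ∈ V₁) (hy : y ∈ V₂)
      (hy' : y' ∈ V₂) : G (v, y) (ξ, 0) (ξ', 0) = G (v, y') (ξ, 0) (ξ', 0) := by
    have hd {y} (hy : y ∈ V₂) : HasFDerivAt (fun y ↦ G (v, y) (ξ, 0) (ξ', 0))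
        (fderiv ℝ (fun z ↦ G z (ξ, 0) (ξ', 0)) (v, y) ∘L ContinuousLinearMap.inr ℝ _ _) y :=
      (dG _ _ ⟨hv, hy⟩).hasFDerivAt.comp y (hasFDerivAt_prodMk_right v y)
    refine oV₂.is_const_of_fderiv_eq_zero (𝕜 := ℝ) (f := fun y ↦ G (v, y) (ξ, 0) (ξ', 0))
      cV₂ (fun y hy ↦ (hd hy).differentiableAt.differentiableWithinAt)
      (fun y hy ↦ ?_) hy hy'
    rw [(hd hy).fderiv]
    ext1 η
    exact fderiv_gram_eq_zero he hDt (hc₁ ξ) (hc₁ ξ') (hc₂ η) (het ▸ ⟨hv, hy⟩)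
  have const₂ (η η' : W₂) {v v' y} (hv : v ∈ V₁) (hv' : v' ∈ V₁)
      (hy : y ∈ V₂) : G (v, y) (0, η) (0, η') = G (v', y) (0, η) (0, η') := by
    have hd {v} (hv : v ∈ V₁) : HasFDerivAt (fun v ↦ G (v, y) (0, η) (0, η'))
        (fderiv ℝ (fun z ↦ G z (0, η) (0, η')) (v, y) ∘L ContinuousLinearMap.inl ℝ _ _) v :=
      (dG _ _ ⟨hv, hy⟩).hasFDerivAt.comp v (hasFDerivAt_prodMk_left v y)
    refine oV₁.is_const_of_fderiv_eq_zero (𝕜 := ℝ) (f := fun v ↦ G (v, y) (0, η) (0, η'))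
      cV₁ (fun v hv ↦ (hd hv).differentiableAt.differentiableWithinAt)
      (fun v hv ↦ ?_) hv hv'
    rw [(hd hv).fderiv]
    ext1 ξ
    exact fderiv_gram_eq_zero he hDt' (hc₂ η) (hc₂ η') (hc₁' ξ) (het ▸ ⟨hv, hy⟩)
  change G z c c' = G (z.1, y₀) (c.1, 0) (c'.1, 0) + G (v₀, z.2) (0, c.2) (0, c'.2)
  rw [const₁ _ _ hz.1 hy₀ hz.2, const₂ _ _ hv₀ hz.1 hz.2]
  have cross (ξ η) : G z (ξ, 0) (0, η) = 0 := by
    have hx' := e.map_target (het ▸ hz)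
    exact (Submodule.mem_orthogonal _ _).1 (hc₂ η _ hx') _ (hc₁ ξ _ hx')
  have cross' (ξ η) : G z (0, η) (ξ, 0) = 0 := (gram_symm _ _ _).trans (cross ξ η)
  have hsplit (c : W₁ × W₂) :
      c = (c.1, 0) + (0, c.2) := by simp
  conv_lhs => rw [hsplit c, hsplit c']
  simp only [map_add, add_apply, cross, cross', add_zero, zero_add]

theorem exists_product_metric [T2Space M] {W₁ W₂ : Type*} [NormedAddCommGroup W₁]
    [NormedSpace ℝ W₁] [FiniteDimensional ℝ W₁] [NormedAddCommGroup W₂] [NormedSpace ℝ W₂]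
    [FiniteDimensional ℝ W₂] (hDt : IsTotallyGeodesic D)
    (hDt' : IsTotallyGeodesic (fun x ↦ (D x)ᗮ)) {e₀ : OpenPartialHomeomorph M (W₁ × W₂)}
    (he₀ : IsSmoothChart E e₀) {p : M} (hp : p ∈ e₀.source)
    (hker₀ : ∀ x ∈ e₀.source, ∀ u : TangentSpace 𝓘(ℝ, E) x,
        (u ∈ D x ↔ (mvfderiv 𝓘(ℝ, E) e₀ x u).2 = 0) ∧
        (u ∈ (D x)ᗮ ↔ (mvfderiv 𝓘(ℝ, E) e₀ x u).1 = 0)) :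
    ∃ (e : OpenPartialHomeomorph M (W₁ × W₂)) (V₁ : Set W₁) (V₂ : Set W₂)
      (h₁ : W₁ → W₁ →L[ℝ] W₁ →L[ℝ] ℝ) (h₂ : W₂ → W₂ →L[ℝ] W₂ →L[ℝ] ℝ),
      p ∈ e.source ∧ e.target = V₁ ×ˢ V₂ ∧
      IsOpen V₁ ∧ IsConnected V₁ ∧ IsOpen V₂ ∧ IsConnected V₂ ∧ IsSmoothChart E e ∧
      ContDiffOn ℝ ∞ h₁ V₁ ∧ (∀ v ∈ V₁, ∀ ξ ξ', h₁ v ξ ξ' = h₁ v ξ' ξ) ∧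
      (∀ v ∈ V₁, ∀ ξ, ξ ≠ 0 → 0 < h₁ v ξ ξ) ∧
      ContDiffOn ℝ ∞ h₂ V₂ ∧ (∀ y ∈ V₂, ∀ η η', h₂ y η η' = h₂ y η' η) ∧
      (∀ y ∈ V₂, ∀ η, η ≠ 0 → 0 < h₂ y η η) ∧
      ∀ x ∈ e.source,
        (∀ u v : TangentSpace 𝓘(ℝ, E) x, (inner ℝ u v : ℝ) =
          h₁ (e x).1 (mvfderiv 𝓘(ℝ, E) (fun z ↦ (e z).1) x u)
              (mvfderiv 𝓘(ℝ, E) (fun z ↦ (e z).1) x v)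
            + h₂ (e x).2 (mvfderiv 𝓘(ℝ, E) (fun z ↦ (e z).2) x u)
              (mvfderiv 𝓘(ℝ, E) (fun z ↦ (e z).2) x v)) ∧
        (∀ u : TangentSpace 𝓘(ℝ, E) x,
          u ∈ D x ↔ mvfderiv 𝓘(ℝ, E) (fun z ↦ (e z).2) x u = 0) ∧
        (∀ u : TangentSpace 𝓘(ℝ, E) x,
          u ∈ (D x)ᗮ ↔ mvfderiv 𝓘(ℝ, E) (fun z ↦ (e z).1) x u = 0) := by
  -- A ball for the sup norm on a product is a product of balls, whose factors are convex and hence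
  -- connected. The factor metrics are those of the slices through the centre `e₀ p`.
  obtain ⟨r, hr, hball⟩ := Metric.isOpen_iff.1 e₀.open_target _ (e₀.map_source hp)
  rw [← Prod.mk.eta (p := e₀ p), ← ball_prod_same] at hball
  set V₁ := Metric.ball (e₀ p).1 r
  set V₂ := Metric.ball (e₀ p).2 r
  have oV₁ : IsOpen V₁ := Metric.isOpen_ball
  have oV₂ : IsOpen V₂ := Metric.isOpen_ball
  have m₁ : (e₀ p).1 ∈ V₁ := Metric.mem_ball_self hr
  have m₂ : (e₀ p).2 ∈ V₂ := Metric.mem_ball_self hr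
  have cV₁ : IsConnected V₁ := ⟨⟨_, m₁⟩, (convex_ball _ _).isPreconnected⟩
  have cV₂ : IsConnected V₂ := ⟨⟨_, m₂⟩, (convex_ball _ _).isPreconnected⟩
  obtain ⟨e, he, hpe, het, hker⟩ : ∃ e : OpenPartialHomeomorph M
      (W₁ × W₂), IsSmoothChart E e ∧ p ∈ e.source ∧
      e.target = V₁ ×ˢ V₂ ∧ ∀ x ∈ e.source, ∀ u : TangentSpace 𝓘(ℝ, E) x,
        (u ∈ D x ↔ (mvfderiv 𝓘(ℝ, E) e x u).2 = 0) ∧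
        (u ∈ (D x)ᗮ ↔ (mvfderiv 𝓘(ℝ, E) e x u).1 = 0) :=
    ⟨_, he₀.restrict (oV₁.prod oV₂), ⟨hp, m₁, m₂⟩, Set.inter_eq_right.2 hball,
      fun x hx u ↦ hker₀ x hx.1 u⟩
  have sG (c c') : ContDiffOn ℝ ∞ (fun z ↦ gram (E := E) e z c c') (V₁ ×ˢ V₂) :=
    het ▸ contDiffOn_gram_apply he c c'
  refine ⟨e, V₁, V₂, gramFst (E := E) e (e₀ p).2, gramSnd (E := E) e (e₀ p).1,
    hpe, het, oV₁, cV₁, oV₂, cV₂, he, ?_, fun v _ ξ ξ' ↦ ?_, fun v hv ξ hξ ↦ ?_,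
    ?_, fun y _ η η' ↦ ?_, fun y hy η hη ↦ ?_, fun x hx ↦ ⟨fun u v ↦ ?_, fun u ↦ ?_, fun u ↦ ?_⟩⟩
  · rw [contDiffOn_clm_apply]
    intro ξ
    rw [contDiffOn_clm_apply]
    intro ξ'
    exact (sG (ξ, 0) (ξ', 0)).comp (contDiff_id.prodMk contDiff_const).contDiffOn
      fun v hv ↦ ⟨hv, m₂⟩
  · rw [gramFst_apply, gramFst_apply, gram_symm]
  · rw [gramFst_apply]
    exact gram_pos he (het ▸ ⟨hv, m₂⟩) fun h ↦ hξ (Prod.ext_iff.1 h).1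
  · rw [contDiffOn_clm_apply]
    intro η
    rw [contDiffOn_clm_apply]
    intro η'
    exact (sG (0, η) (0, η')).comp (contDiff_const.prodMk contDiff_id).contDiffOn
      fun v hv ↦ ⟨m₁, hv⟩
  · rw [gramSnd_apply, gramSnd_apply, gram_symm]
  · rw [gramSnd_apply]
    exact gram_pos he (het ▸ ⟨m₁, hy⟩) fun h ↦ hη (Prod.ext_iff.1 h).2
  · have hex : e x ∈ V₁ ×ˢ V₂ := het ▸ e.map_source hx
    rw [mvfderiv_fst (he.mdifferentiableAt hx), mvfderiv_fst (he.mdifferentiableAt hx),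
      mvfderiv_snd (he.mdifferentiableAt hx), mvfderiv_snd (he.mdifferentiableAt hx)]
    rw [← gram_mvfderiv he hx u v, gramFst_apply, gramSnd_apply]
    exact gram_eq_add_of_product he hDt hDt' oV₁ cV₁.isPreconnected oV₂ cV₂.isPreconnected het hker
      m₁ m₂ hex _ _
  · rw [mvfderiv_snd (he.mdifferentiableAt hx)]
    exact (hker x hx u).1
  · rw [mvfderiv_fst (he.mdifferentiableAt hx)]
    exact (hker x hx u).2

theorem isLocalRiemannianProduct_of_isTotallyGeodesic [T2Space M] (hD : IsSmoothSplitting D)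
    (hDt : IsTotallyGeodesic D) (hDt' : IsTotallyGeodesic (fun x ↦ (D x)ᗮ)) :
    IsLocalRiemannianProduct D := by
  intro p
  obtain ⟨a, b, e₀, he₀, hp, hker₀⟩ := exists_product_chart hD hDt hDt' p
  obtain ⟨e, V₁, V₂, h₁, h₂, hpe, het, oV₁, cV₁, oV₂, cV₂, he, s₁, sy₁, p₁, s₂, sy₂, p₂, H⟩ :=
    exists_product_metric hDt hDt' he₀ hp hker₀
  exact ⟨a, b, e, V₁, V₂, h₁, h₂, hpe, het, oV₁, cV₁, oV₂, cV₂, ⟨s₁, sy₁, p₁⟩, ⟨s₂, sy₂, p₂⟩,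
    he.smooth, he.smooth_symm, H⟩

end Converse

end HSemiSlant

end

theorem theorem4p1
    {E : Type*} [NormedAddCommGroup E] [NormedSpace ℝ E] [FiniteDimensional ℝ E]
    {M : Type*} [TopologicalSpace M] [T2Space M] [ChartedSpace E M] [IsManifold 𝓘(ℝ, E) ∞ M]
    [RiemannianBundle (fun x : M ↦ TangentSpace 𝓘(ℝ, E) x)]
    [IsContMDiffRiemannianBundle 𝓘(ℝ, E) ∞ E (fun x : M ↦ TangentSpace 𝓘(ℝ, E) x)]
    {E' : Type*} [NormedAddCommGroup E'] [NormedSpace ℝ E'] [FiniteDimensional ℝ E']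
    {N : Type*} [TopologicalSpace N] [T2Space N] [ChartedSpace E' N] [IsManifold 𝓘(ℝ, E') ∞ N]
    [RiemannianBundle (fun y : N ↦ TangentSpace 𝓘(ℝ, E') y)]
    [IsContMDiffRiemannianBundle 𝓘(ℝ, E') ∞ E' (fun y : N ↦ TangentSpace 𝓘(ℝ, E') y)]
    (J : Fin 3 → HSemiSlant.EndField E M) (hJ : HSemiSlant.IsHyperkahler J)
    (F : M → N) (hF : HSemiSlant.IsAlmostHSemiSlant E' F J) :
    List.TFAE [
      HSemiSlant.IsLocalRiemannianProduct (HSemiSlant.kerField E E' F),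
      HSemiSlant.VerticalIdentity (HSemiSlant.kerField E E' F) (J 0) ∧
        HSemiSlant.HorizontalIdentity (HSemiSlant.kerField E E' F) (J 0),
      HSemiSlant.VerticalIdentity (HSemiSlant.kerField E E' F) (J 1) ∧
        HSemiSlant.HorizontalIdentity (HSemiSlant.kerField E E' F) (J 1),
      HSemiSlant.VerticalIdentity (HSemiSlant.kerField E E' F) (J 2) ∧
        HSemiSlant.HorizontalIdentity (HSemiSlant.kerField E E' F) (J 2)] := by
  have hD := hF.1.isSmoothSplitting
  have h (a : Fin 3) : HSemiSlant.VerticalIdentity (HSemiSlant.kerField E E' F) (J a) ∧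
      HSemiSlant.HorizontalIdentity (HSemiSlant.kerField E E' F) (J a) ↔
      HSemiSlant.IsLocalRiemannianProduct (HSemiSlant.kerField E E' F) := by
    rw [HSemiSlant.horizontalIdentity_iff_verticalIdentity_orthogonal,
      HSemiSlant.verticalIdentity_iff_isTotallyGeodesic hD hJ,
      HSemiSlant.verticalIdentity_iff_isTotallyGeodesic hD.orthogonal hJ]
    exact ⟨fun h ↦ HSemiSlant.isLocalRiemannianProduct_of_isTotallyGeodesic hD h.1 h.2,
      fun h ↦ h.isTotallyGeodesic hD⟩
  simp only [h]
  tfae_finish
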